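/- **Setting.** Consider a two-player zero-sum discounted Markov game with state space $\mathcal S=\{1,\dots,S\}$, action spaces $\mathcal A=\{1,\dots,A\}$ (min-player) and $\mathcal B=\{1,\dots,B\}$ (max-player), $S,A,B\ge 1$, transition kernel $\mathbb P(\cdot\mid s,a,b)\in\Delta_{\mathcal S}$, rewards $R_s\in[0,1]^{A\times B}$ and discount factor $\gamma\in[0,1)$. Policies are $x=(x_s)_s\in\mathcal X=(\Delta_{\mathcal A})^S$ and $y=(y_s)_s\in\mathcal Y=(\Delta_{\mathcal B})^S$; a pair $z=(x,y)$ is regarded as a vector in $\mathbb R^{(A+B)S}$ with the Euclidean norm, and $\mathrm{dist}$ is the Euclidean distance to a set. Let $V^{x,y}(s)=\mathbb E_{x,y}\big[\sum_{t\ge0}\gamma^tR_{s^t}(a^t,b^t)\,\big|\,s^0=s\big]$, where $a^t\sim x_{s^t}$, $b^t\sim y_{s^t}$, $s^{t+1}\sim\mathbb P(\cdot\mid s^t,a^t,b^t)$, and let $$V^{x,\dagger}(s)=\max_{y'\in\mathcal Y}V^{x,y'}(s),\qquad V^{\dagger,y}(s)=\min_{x'\in\mathcal X}V^{x',y}(s),\qquad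 v^*(s)=\min_{x\in\mathcal X}\max_{y\in\mathcal Y}V^{x,y}(s).$$ For $v\in\mathbb R^S$ let $Q_s[v](a,b)=R_s(a,b)+\gamma\sum_{s'}\mathbb P(s'\mid s,a,b)v(s')$, and $Q^*_s=Q_s[v^*]$. The set of Nash equilibria is $Z^*=\prod_s X^*_s\times Y^*_s$ with $$X^*_s=\operatorname*{argmin}_{u\in\Delta_{\mathcal A}}\max_{w\in\Delta_{\mathcal B}}\langle u,Q^*_sw\rangle,\qquad Y^*_s=\operatorname*{argmax}_{w\in\Delta_{\mathcal B}}\min_{u\in\Delta_{\mathcal A}}\langle u,Q^*_sw\rangle.$$ **Averaging OGDA.** Let $\alpha_t=\frac{H+1}{H+t}$ with $H=\frac{1+\gamma}{1-\gamma}$, and $\alpha_t^j=\alpha_j\prod_{k=j+1}^t(1-\alpha_k)$ for $1\le j\le t$ (so $\alpha_t^t=\alpha_t$). For integers $0\le T_1\le T_2$, an initial policy pair $z_{\mathrm{in}}=(x_{\mathrm{in}},y_{\mathrm{in}})\in\mathcal X\times\mathcal Y$ and a stepsize $\eta'>0$, set $\tilde x^{T_1}=x^{T_1}=x_{\mathrm{in}}$,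 $\tilde y^{T_1}=y^{T_1}=y_{\mathrm{in}}$, $\underline V^{T_1}=V^{\dagger,y_{\mathrm{in}}}$, $\overline V^{T_1}=V^{x_{\mathrm{in}},\dagger}$. For $T_1<t\le T_2$ and every $s$, with $\underline q^j_s=Q_s[\underline V^j]y^j_s$, $\overline q^j_s=Q_s[\overline V^j]^\top x^j_s$ and $P_{\mathcal C}$ the Euclidean projection onto $\mathcal C$, set $$\underline V^t(s)=\min_{a\in\mathcal A}\sum_{j=T_1}^{t-1}\alpha_{t-T_1}^{j-T_1+1}\underline q^j_s(a),\qquad \overline V^t(s)=\max_{b\in\mathcal B}\sum_{j=T_1}^{t-1}\alpha_{t-T_1}^{j-T_1+1}\overline q^j_s(b),$$ $$x^t_s=P_{\Delta_{\mathcal A}}(\tilde x^{t-1}_s-\eta'\underline q^{t-1}_s),\qquad y^t_s=P_{\Delta_{\mathcal B}}(\tilde y^{t-1}_s+\eta'\overline q^{t-1}_s),$$ $$\tilde x^t_s=P_{\Delta_{\mathcal A}}(\tilde x^{t-1}_s-\eta'\underline q^{t}_s),\qquad \tilde y^t_s=P_{\Delta_{\mathcal B}}(\tilde y^{t-1}_s+\eta'\overline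 q^{t}_s).$$ Let $z^t=(x^t,y^t)$ and $\hat z^{[T_1:T_2]}=\sum_{t=T_1}^{T_2}\alpha_{T_2-T_1+1}^{t-T_1+1}z^t$. **Theorem 4 (Geometric Boundedness of Averaging OGDA).** There is an absolute constant $C>0$ such that every game as above admits a constant $D>0$, depending only on the game, with $$D\le C\,\frac{S(A+B)^2}{(1-\gamma)^4},$$ such that for all stepsizes $0<\eta'\le1$, all integers $0\le T_1\le T_2$ and all initial policy pairs $z_{\mathrm{in}}$, the policy pairs generated by Averaging OGDA satisfy $$\mathrm{dist}^2(z^t,Z^*)\le D^{\,t-T_1}\,\mathrm{dist}^2(z_{\mathrm{in}},Z^*)\quad\text{for all } t\in\{T_1,\dots,T_2\},$$ $$\mathrm{dist}^2(\hat z^{[T_1:T_2]},Z^*)\le D^{\,T_2-T_1}\,\mathrm{dist}^2(z_{\mathrm{in}},Z^*).$$ -/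

import Mathlib

noncomputable section

namespace MG

open MeasureTheory ProbabilityTheory

/-- A two-player zero-sum discounted Markov game with state space `Fin S`, action space `Fin A` for
the min-player and `Fin B` for the max-player. -/
structure MarkovGame (S A B : ℕ) where
  /-- `P s a b s'` is the probability that the next state is `s'`. -/
  P : Fin S → Fin A → Fin B → stdSimplex ℝ (Fin S)
  /-- `R s a b` is the reward received by the max-player. -/
  R : Fin S → Matrix (Fin A) (Fin B) ℝ
  /-- The discount factor. -/
  γ : ℝ
  R_mem : ∀ s a b, R s a b ∈ Set.Icc (0 : ℝ) 1
  γ_nonneg : 0 ≤ γ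
  γ_lt_one : γ < 1

/-- A policy of a player with `n` actions: a point of the simplex for every state. -/
abbrev Policy (S n : ℕ) := Fin S → stdSimplex ℝ (Fin n)

/-! ### Value functions -/

/-- A point of the standard simplex as a probability distribution. -/
def toPMF {n : ℕ} (p : stdSimplex ℝ (Fin n)) : PMF (Fin n) :=
  PMF.ofFintype (fun i => ENNReal.ofReal (p.1 i)) (by
    rw [← ENNReal.ofReal_sum_of_nonneg (fun i _ => p.2.1 i), p.2.2, ENNReal.ofReal_one])

section Value

variable {S A B : ℕ} (G : MarkovGame S A B) (x : Policy S A) (y : Policy S B)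

/-- Law of the triple `(s, a, b)` with `a ∼ x_s` and `b ∼ y_s` drawn independently. -/
def actLaw (s : Fin S) : PMF (Fin S × Fin A × Fin B) :=
  (toPMF (x s)).bind fun a => (toPMF (y s)).map fun b => (s, a, b)

/-- Law of `(s^{t+1}, a^{t+1}, b^{t+1})` given `(s^t, a^t, b^t) = w`. -/
def stepLaw (w : Fin S × Fin A × Fin B) : PMF (Fin S × Fin A × Fin B) :=
  (toPMF (G.P w.1 w.2.1 w.2.2)).bind (actLaw x y)

/-- The transition kernel of the trajectory: the next triple depends on the last one only. -/
def stepKernel (n : ℕ) :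
    Kernel ((i : Finset.Iic n) → (fun _ : ℕ => Fin S × Fin A × Fin B) i)
      (Fin S × Fin A × Fin B) :=
  Kernel.ofFunOfCountable fun h => (stepLaw G x y (h ⟨n, Finset.mem_Iic.2 le_rfl⟩)).toMeasure

instance (n : ℕ) : IsMarkovKernel (stepKernel G x y n) :=
  ⟨fun h => PMF.toMeasure.isProbabilityMeasure
    (stepLaw G x y (h ⟨n, Finset.mem_Iic.2 le_rfl⟩))⟩

/-- Law of the trajectory `(s^t, a^t, b^t)_{t ≥ 0}` under `(x, y)` given `s^0 = s`. -/
def trajLaw (s : Fin S) : Measure (ℕ → Fin S × Fin A × Fin B) :=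
  Kernel.trajMeasure (X := fun _ : ℕ => Fin S × Fin A × Fin B)
    (actLaw x y s).toMeasure (stepKernel G x y)

/-- `V^{x,y}(s)`: the expected discounted cumulative reward under `(x, y)` from the state `s`. -/
def value (s : Fin S) : ℝ :=
  ∫ ω, ∑' t : ℕ, G.γ ^ t * G.R (ω t).1 (ω t).2.1 (ω t).2.2 ∂(trajLaw G x y s)

/-- `V^{x,†}(s) = max_{y'} V^{x,y'}(s)`. -/
def valueMaxResp (s : Fin S) : ℝ := ⨆ y' : Policy S B, value G x y' s

/-- `V^{†,y}(s) = min_{x'} V^{x',y}(s)`. -/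
def valueMinResp (s : Fin S) : ℝ := ⨅ x' : Policy S A, value G x' y s

/-- The minimax game value `v^*(s) = min_x max_y V^{x,y}(s)`. -/
def gameValue (s : Fin S) : ℝ := ⨅ x' : Policy S A, valueMaxResp G x' s

/-- The Bellman target operator
`Q_s[v](a,b) = R_s(a,b) + γ ∑_{s'} P(s'|s,a,b) v(s')`. -/
def bellman (s : Fin S) (v : Fin S → ℝ) : Matrix (Fin A) (Fin B) ℝ :=
  fun a b => G.R s a b + G.γ * ∑ s', G.P s a b s' * v s'

end Value

/-! ### Policy pairs as Euclidean vectors and the set of Nash equilibria -/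

/-- `n`-action policies as vectors of the Euclidean space of dimension `S * n`. -/
abbrev PolSpace (S n : ℕ) := PiLp 2 fun _ : Fin S => EuclideanSpace ℝ (Fin n)

/-- Policy pairs as vectors of the Euclidean space of dimension `S * A + S * B`. -/
abbrev PairSpace (S A B : ℕ) := WithLp 2 (PolSpace S A × PolSpace S B)

/-- The probability simplex in Euclidean space. -/
def simplex (n : ℕ) : Set (EuclideanSpace ℝ (Fin n)) := {v | ⇑v ∈ stdSimplex ℝ (Fin n)}

/-- The vector of a policy. -/
def Policy.toVec {S n : ℕ} (x : Policy S n) : PolSpace S n :=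
  WithLp.toLp 2 fun s => WithLp.toLp 2 fun a => x s a

/-- The vector of a policy pair. -/
def pairVec {S A B : ℕ} (x : PolSpace S A) (y : PolSpace S B) : PairSpace S A B :=
  WithLp.toLp 2 (x, y)

section Nash

variable {S A B : ℕ} (G : MarkovGame S A B)

/-- The minimax Q-function `Q^*_s = Q_s[v^*]`. -/
def Qstar (s : Fin S) : Matrix (Fin A) (Fin B) ℝ := bellman G s (gameValue G)

/-- `⟨u, Q^*_s w⟩`. -/
def payoff (s : Fin S) (u : EuclideanSpace ℝ (Fin A)) (w : EuclideanSpace ℝ (Fin B)) : ℝ :=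
  ⇑u ⬝ᵥ (Qstar G s).mulVec ⇑w

/-- `X^*_s`: the minimizers over the simplex of `u ↦ max_w ⟨u, Q^*_s w⟩`. -/
def XstarAt (s : Fin S) : Set (EuclideanSpace ℝ (Fin A)) :=
  {u | u ∈ simplex A ∧ IsMinOn (fun u' => ⨆ w : simplex B, payoff G s u' w) (simplex A) u}

/-- `Y^*_s`: the maximizers over the simplex of `w ↦ min_u ⟨u, Q^*_s w⟩`. -/
def YstarAt (s : Fin S) : Set (EuclideanSpace ℝ (Fin B)) :=
  {w | w ∈ simplex B ∧ IsMaxOn (fun w' => ⨅ u : simplex A, payoff G s u w') (simplex B) w}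

/-- The set of Nash equilibria `Z^* = ∏_s X^*_s × Y^*_s`. -/
def Zstar : Set (PairSpace S A B) :=
  {z | ∀ s, z.fst s ∈ XstarAt G s ∧ z.snd s ∈ YstarAt G s}

end Nash

/-! ### Averaging OGDA -/

/-- A point of `C` nearest to `v`; for nonempty closed convex `C` it is the unique projection. -/
def proj {n : ℕ} (C : Set (EuclideanSpace ℝ (Fin n))) (v : EuclideanSpace ℝ (Fin n)) :
    EuclideanSpace ℝ (Fin n) :=
  Classical.epsilon fun p => p ∈ C ∧ ∀ q ∈ C, ‖v - p‖ ≤ ‖v - q‖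

/-- `α_t = (H + 1) / (H + t)` with `H = (1 + γ) / (1 - γ)`. -/
def stepα (γ : ℝ) (t : ℕ) : ℝ := ((1 + γ) / (1 - γ) + 1) / ((1 + γ) / (1 - γ) + t)

/-- `α_t^j = α_j ∏_{k=j+1}^t (1 - α_k)` for `j ≤ t`; in particular `α_t^t = α_t`. -/
def avgα (γ : ℝ) (t j : ℕ) : ℝ := stepα γ j * ∏ k ∈ Finset.Icc (j + 1) t, (1 - stepα γ k)

/-- The variables `x^t, x̃^t, V̲^t` of the min-player and `y^t, ỹ^t, V̅^t` of the max-player. -/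
structure Iterate (S A B : ℕ) where
  x : PolSpace S A
  xt : PolSpace S A
  y : PolSpace S B
  yt : PolSpace S B
  Vlo : Fin S → ℝ
  Vhi : Fin S → ℝ

section Algorithm

variable {S A B : ℕ} (G : MarkovGame S A B)

/-- `q̲_s = Q_s[V̲] y_s`. -/
def qlo (V : Fin S → ℝ) (y : PolSpace S B) (s : Fin S) : EuclideanSpace ℝ (Fin A) :=
  WithLp.toLp 2 ((bellman G s V).mulVec ⇑(y s))

/-- `q̅_s = Q_s[V̅]ᵀ x_s`. -/
def qhi (V : Fin S → ℝ) (x : PolSpace S A) (s : Fin S) : EuclideanSpace ℝ (Fin B) :=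
  WithLp.toLp 2 ((bellman G s V).transpose.mulVec ⇑(x s))

/-- `aogdaAfter G η x₀ y₀ k` holds the variables of Averaging OGDA at iteration `T₁ + k`, when it is
started at iteration `T₁` from the policy pair `(x₀, y₀)` with stepsize `η`. -/
def aogdaAfter (η : ℝ) (x₀ : Policy S A) (y₀ : Policy S B) : ℕ → Iterate S A B
  | 0 =>
    { x := x₀.toVec, xt := x₀.toVec, y := y₀.toVec, yt := y₀.toVec
      Vlo := valueMinResp G y₀, Vhi := valueMaxResp G x₀ }
  | k + 1 =>
    let past : Fin (k + 1) → Iterate S A B := fun j => aogdaAfter η x₀ y₀ j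
    let last := past (Fin.last k)
    let Vlo : Fin S → ℝ := fun s =>
      ⨅ a : Fin A, ∑ j : Fin (k + 1),
        avgα G.γ (k + 1) (j + 1) * qlo G (past j).Vlo (past j).y s a
    let Vhi : Fin S → ℝ := fun s =>
      ⨆ b : Fin B, ∑ j : Fin (k + 1),
        avgα G.γ (k + 1) (j + 1) * qhi G (past j).Vhi (past j).x s b
    let x : PolSpace S A := WithLp.toLp 2 fun s =>
      proj (simplex A) (last.xt s - η • qlo G last.Vlo last.y s)
    let y : PolSpace S B := WithLp.toLp 2 fun s =>
      proj (simplex B) (last.yt s + η • qhi G last.Vhi last.x s)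
    { x := x
      xt := WithLp.toLp 2 fun s => proj (simplex A) (last.xt s - η • qlo G Vlo y s)
      y := y
      yt := WithLp.toLp 2 fun s => proj (simplex B) (last.yt s + η • qhi G Vhi x s)
      Vlo := Vlo
      Vhi := Vhi }
  termination_by k => k
  decreasing_by exact j.2

/-- The variables at iteration `t ≥ T₁` of Averaging OGDA started at iteration `T₁`. -/
def aogda (η : ℝ) (x₀ : Policy S A) (y₀ : Policy S B) (T₁ t : ℕ) : Iterate S A B :=
  aogdaAfter G η x₀ y₀ (t - T₁)

/-- The policy pair `z^t = (x^t, y^t)` played at iteration `t ≥ T₁`. -/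
def played (η : ℝ) (x₀ : Policy S A) (y₀ : Policy S B) (T₁ t : ℕ) : PairSpace S A B :=
  pairVec (aogda G η x₀ y₀ T₁ t).x (aogda G η x₀ y₀ T₁ t).y

/-- The average policy pair
`ẑ^{[T₁:T₂]} = ∑_{t=T₁}^{T₂} α_{T₂-T₁+1}^{t-T₁+1} z^t`, for `T₁ ≤ T₂`. -/
def averagePair (η : ℝ) (x₀ : Policy S A) (y₀ : Policy S B) (T₁ T₂ : ℕ) : PairSpace S A B :=
  pairVec
    (∑ t ∈ Finset.Icc T₁ T₂, avgα G.γ (T₂ - T₁ + 1) (t - T₁ + 1) • (aogda G η x₀ y₀ T₁ t).x)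
    (∑ t ∈ Finset.Icc T₁ T₂, avgα G.γ (T₂ - T₁ + 1) (t - T₁ + 1) • (aogda G η x₀ y₀ T₁ t).y)

end Algorithm

end MG

end

noncomputable section

namespace MG

open MeasureTheory ProbabilityTheory Matrix

/-! ### Expectations under distributions on finite types -/

/-! Fix one equilibrium `z' = (x', y')`. It is enough that each iteration moves the policies away
from `z'` by at most a constant factor `g`, the same for all equilibria. Taking the infimum over
`z'` (`infDist_le_mul_infDist`) gives the bound for the distance to `Zstar`, with `D = g ^ 2`. No
convergence is needed, only Lipschitz control around a stationary point.

Stationarity has two halves. By the saddle property, `x'` solves the variational inequality of `q' =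
Q^* y'`, hence is fixed by the projected step along `q'`. Nonexpansiveness of the projection then
bounds the new policy error by the old one plus the error of the `q`-vector
(`norm_projected_step_sub_le`). Also `v^*(s)` is the least entry of `Q^*_s y'_s` and the largest of
`(Q^*_s)ᵀ x'_s`. Minimum and maximum are 1-Lipschitz in the sup norm and the averaging weights sum
to one, so value errors are bounded by past `q`-errors (`abs_iInf_sub_gameValue_le`,
`abs_iSup_sub_gameValue_le`). A `q`-error is in turn at most `γ` times the value error plus `√(A +
B) / (1 - γ)` times the policy error. `Near.succ` combines these estimates and `near_aogdaAfter`
closes the induction.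

Two inputs come from the Markov game itself. Shapley's theorem (`exists_optimal`) identifies the
minimax value, defined through trajectories, with the values of the matrix games `Q^*_s`; it rests
on the Bellman equation `value_eq_dotProduct`. The initial best-response values are Lipschitz at
`z'` with constant of order `√(A + B) / (1 - γ) ^ 2` (`abs_valueMinResp_sub_le`,
`abs_valueMaxResp_sub_le`). -/

theorem integral_bind_fintype {α β : Type*} [Fintype α] [Fintype β] [MeasurableSpace α]
    [MeasurableSingletonClass α] [MeasurableSpace β] [MeasurableSingletonClass β]
    (p : PMF α) (q : α → PMF β) (f : β → ℝ) :
    ∫ b, f b ∂(p.bind q).toMeasure = ∑ a, (p a).toReal * ∫ b, f b ∂(q a).toMeasure := by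
  simp only [PMF.integral_eq_sum, smul_eq_mul, PMF.bind_apply, tsum_fintype, Finset.mul_sum]
  rw [Finset.sum_comm]
  refine Finset.sum_congr rfl fun b _ => ?_
  rw [ENNReal.toReal_sum fun a _ =>
    ENNReal.mul_ne_top (PMF.apply_ne_top _ _) (PMF.apply_ne_top _ _), Finset.sum_mul]
  exact Finset.sum_congr rfl fun a _ => by rw [ENNReal.toReal_mul, mul_assoc]

theorem toPMF_toReal {n : ℕ} (p : stdSimplex ℝ (Fin n)) (i : Fin n) :
    (toPMF p i).toReal = p i :=
  ENNReal.toReal_ofReal (p.2.1 i)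

section Value

variable {S A B : ℕ} (G : MarkovGame S A B) (x : Policy S A) (y : Policy S B)

theorem integral_actLaw (s : Fin S) (f : Fin S × Fin A × Fin B → ℝ) :
    ∫ w, f w ∂(actLaw x y s).toMeasure = ∑ a, ∑ b, x s a * (y s b * f (s, a, b)) := by
  simp only [actLaw, PMF.map, integral_bind_fintype, Function.comp_def, PMF.toMeasure_pure,
    integral_dirac, toPMF_toReal, Finset.mul_sum]

theorem integral_stepLaw (w : Fin S × Fin A × Fin B) (f : Fin S × Fin A × Fin B → ℝ) :
    ∫ w', f w' ∂(stepLaw G x y w).toMeasure =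
      ∑ s', G.P w.1 w.2.1 w.2.2 s' * ∑ a, ∑ b, x s' a * (y s' b * f (s', a, b)) := by
  simp only [stepLaw, integral_bind_fintype, integral_actLaw, toPMF_toReal]

instance (s : Fin S) : IsProbabilityMeasure (trajLaw G x y s) := by
  unfold trajLaw
  infer_instance

theorem integrable_coord (s : Fin S) (t : ℕ) (f : Fin S × Fin A × Fin B → ℝ) :
    Integrable (fun ω : ℕ → Fin S × Fin A × Fin B => f (ω t)) (trajLaw G x y s) := by
  obtain ⟨C, hC⟩ := (Set.finite_range fun w => ‖f w‖).bddAbove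
  refine Integrable.of_bound (Measurable.aestronglyMeasurable ?_) C
    (Filter.Eventually.of_forall fun ω => hC ⟨ω t, rfl⟩)
  exact (measurable_of_finite f).comp (measurable_pi_apply t)

/-- Markov property: the joint law of the history up to `t` and the next triple is a
composition-product whose kernel sees only the last triple, so the next triple can be integrated out
first. -/
theorem integral_coord_succ (s : Fin S) (t : ℕ) (f : Fin S × Fin A × Fin B → ℝ) :
    ∫ ω, f (ω (t + 1)) ∂(trajLaw G x y s) =
      ∫ ω, (∫ w', f w' ∂(stepLaw G x y (ω t)).toMeasure) ∂(trajLaw G x y s) := by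
  have h := Kernel.map_frestrictLe_trajMeasure_compProd_eq_map_trajMeasure
    (X := fun _ : ℕ => Fin S × Fin A × Fin B)
    (μ₀ := (actLaw x y s).toMeasure) (κ := stepKernel G x y) (a := t)
  have hf : Measurable f := measurable_of_finite f
  have h2 := congrArg (fun m => ∫ p, f p.2 ∂m) h
  beta_reduce at h2
  have hm : Measurable fun ω : ℕ → Fin S × Fin A × Fin B =>
      (Preorder.frestrictLe (π := fun _ => Fin S × Fin A × Fin B) t ω, ω (t + 1)) := by fun_prop
  have hf2 : Measurable fun p :
      ((i : Finset.Iic t) → (fun _ : ℕ => Fin S × Fin A × Fin B) i) × (Fin S × Fin A × Fin B) =>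
      f p.2 := hf.comp measurable_snd
  have hb : ∃ C, ∀ w, ‖f w‖ ≤ C := by
    obtain ⟨C, hC⟩ := (Set.finite_range fun w => ‖f w‖).bddAbove
    exact ⟨C, fun w => hC ⟨w, rfl⟩⟩
  obtain ⟨C, hC⟩ := hb
  have : IsProbabilityMeasure ((Kernel.trajMeasure (X := fun _ : ℕ => Fin S × Fin A × Fin B)
      (actLaw x y s).toMeasure (stepKernel G x y)).map (Preorder.frestrictLe t)) :=
    Measure.isProbabilityMeasure_map (by fun_prop)
  rw [integral_map hm.aemeasurable hf2.aestronglyMeasurable,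
    Measure.integral_compProd (Integrable.of_bound hf2.aestronglyMeasurable C
      (Filter.Eventually.of_forall fun p => hC _)),
    integral_map (Measurable.aemeasurable (by fun_prop))
      (Measurable.aestronglyMeasurable (measurable_of_countable _))] at h2
  exact h2.symm

theorem integral_coord_zero (s : Fin S) (f : Fin S × Fin A × Fin B → ℝ) :
    ∫ ω, f (ω 0) ∂(trajLaw G x y s) = ∫ w, f w ∂(actLaw x y s).toMeasure := by
  have hf : Measurable f := measurable_of_finite f
  have hm : (trajLaw G x y s).map (Preorder.frestrictLe (π := fun _ => Fin S × Fin A × Fin B) 0) =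
      (actLaw x y s).toMeasure.map
        (MeasurableEquiv.piUnique fun _ : Finset.Iic 0 => Fin S × Fin A × Fin B).symm := by
    rw [trajLaw, Kernel.trajMeasure, Measure.map_comp _ _ (by fun_prop),
      Kernel.traj_map_frestrictLe, Kernel.partialTraj_self, Measure.id_comp]
  have hg : Measurable fun h : (Finset.Iic 0) → Fin S × Fin A × Fin B => f (h default) :=
    hf.comp (measurable_pi_apply _)
  have h1 := congrArg (fun m => ∫ h, f (h default) ∂m) hm
  beta_reduce at h1
  rw [integral_map (by fun_prop) hg.aestronglyMeasurable,
    integral_map (by fun_prop) hg.aestronglyMeasurable] at h1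
  exact h1

/-- One step of the Markov chain on triples `(s, a, b)`, acting on functions. -/
def stepOp (f : Fin S × Fin A × Fin B → ℝ) (w : Fin S × Fin A × Fin B) : ℝ :=
  ∑ s', G.P w.1 w.2.1 w.2.2 s' * ∑ a, ∑ b, x s' a * (y s' b * f (s', a, b))

theorem integral_coord (s : Fin S) (t : ℕ) (f : Fin S × Fin A × Fin B → ℝ) :
    ∫ ω, f (ω t) ∂(trajLaw G x y s) =
      ∑ a, ∑ b, x s a * (y s b * (stepOp G x y)^[t] f (s, a, b)) := by
  induction t generalizing f with
  | zero => rw [integral_coord_zero, integral_actLaw]; rfl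
  | succ t ih =>
    rw [integral_coord_succ, Function.iterate_succ_apply, ← ih]
    simp only [integral_stepLaw]
    rfl

theorem sum_sum_mem_Icc {n m : ℕ} {u : Fin n → ℝ} {w : Fin m → ℝ}
    (hu : u ∈ stdSimplex ℝ (Fin n)) (hw : w ∈ stdSimplex ℝ (Fin m)) {f : Fin n → Fin m → ℝ}
    (hf : ∀ a b, f a b ∈ Set.Icc (0 : ℝ) 1) :
    ∑ a, ∑ b, u a * (w b * f a b) ∈ Set.Icc (0 : ℝ) 1 := by
  refine ⟨Finset.sum_nonneg fun a _ => Finset.sum_nonneg fun b _ =>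
    mul_nonneg (hu.1 a) (mul_nonneg (hw.1 b) (hf a b).1), ?_⟩
  calc ∑ a, ∑ b, u a * (w b * f a b) ≤ ∑ a, ∑ b, u a * w b := by
        refine Finset.sum_le_sum fun a _ => Finset.sum_le_sum fun b _ => ?_
        exact mul_le_mul_of_nonneg_left (mul_le_of_le_one_right (hw.1 b) (hf a b).2) (hu.1 a)
    _ = 1 := by simp only [← Finset.mul_sum, hw.2, mul_one, hu.2]

theorem stepOp_mem_Icc {f : Fin S × Fin A × Fin B → ℝ} (hf : ∀ w, f w ∈ Set.Icc (0 : ℝ) 1)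
    (w : Fin S × Fin A × Fin B) : stepOp G x y f w ∈ Set.Icc (0 : ℝ) 1 := by
  have h : ∀ s', ∑ a, ∑ b, x s' a * (y s' b * f (s', a, b)) ∈ Set.Icc (0 : ℝ) 1 :=
    fun s' => sum_sum_mem_Icc (x s').2 (y s').2 fun a b => hf _
  have hp := (G.P w.1 w.2.1 w.2.2).2
  refine ⟨Finset.sum_nonneg fun s' _ => mul_nonneg (hp.1 s') (h s').1, ?_⟩
  calc _ ≤ ∑ s', G.P w.1 w.2.1 w.2.2 s' :=
        Finset.sum_le_sum fun s' _ => mul_le_of_le_one_right (hp.1 s') (h s').2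
    _ = 1 := hp.2

/-- The reward as a function of the triple `(s, a, b)`. -/
def reward (w : Fin S × Fin A × Fin B) : ℝ := G.R w.1 w.2.1 w.2.2

theorem iterate_stepOp_reward_mem_Icc (t : ℕ) (w : Fin S × Fin A × Fin B) :
    (stepOp G x y)^[t] (reward G) w ∈ Set.Icc (0 : ℝ) 1 := by
  induction t generalizing w with
  | zero => exact G.R_mem _ _ _
  | succ t ih =>
    rw [Function.iterate_succ_apply']
    exact stepOp_mem_Icc G x y ih w

/-- The expected discounted reward given the first triple. -/
def actionValue (w : Fin S × Fin A × Fin B) : ℝ :=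
  ∑' t : ℕ, G.γ ^ t * (stepOp G x y)^[t] (reward G) w

theorem hasSum_actionValue (w : Fin S × Fin A × Fin B) :
    HasSum (fun t : ℕ => G.γ ^ t * (stepOp G x y)^[t] (reward G) w) (actionValue G x y w) := by
  refine (Summable.of_nonneg_of_le (fun t => ?_) (fun t => ?_)
    (summable_geometric_of_lt_one G.γ_nonneg G.γ_lt_one)).hasSum
  · exact mul_nonneg (pow_nonneg G.γ_nonneg t) (iterate_stepOp_reward_mem_Icc G x y t w).1
  · exact mul_le_of_le_one_right (pow_nonneg G.γ_nonneg t)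
      (iterate_stepOp_reward_mem_Icc G x y t w).2

/-- Sum and integral may be exchanged because the terms are nonnegative with summable integrals; the
conditional expectations lie in `[0, 1]`, so the discounts dominate. -/
theorem value_eq_sum_actionValue (s : Fin S) :
    value G x y s = ∑ a, ∑ b, x s a * (y s b * actionValue G x y (s, a, b)) := by
  have hint : ∀ t : ℕ, Integrable
      (fun ω : ℕ → Fin S × Fin A × Fin B => G.γ ^ t * reward G (ω t)) (trajLaw G x y s) :=
    fun t => (integrable_coord G x y s t (reward G)).const_mul _
  have hval : ∀ t : ℕ, ∫ ω, G.γ ^ t * reward G (ω t) ∂(trajLaw G x y s) =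
      ∑ a, ∑ b, x s a * (y s b * (G.γ ^ t * (stepOp G x y)^[t] (reward G) (s, a, b))) := by
    intro t
    rw [integral_const_mul, integral_coord, Finset.mul_sum]
    refine Finset.sum_congr rfl fun a _ => ?_
    rw [Finset.mul_sum]
    exact Finset.sum_congr rfl fun b _ => by ring
  have hsum : HasSum (fun t : ℕ => ∫ ω, G.γ ^ t * reward G (ω t) ∂(trajLaw G x y s))
      (∑ a, ∑ b, x s a * (y s b * actionValue G x y (s, a, b))) := by
    simp only [hval]
    exact hasSum_sum fun a _ => hasSum_sum fun b _ =>
      ((hasSum_actionValue G x y (s, a, b)).mul_left _).mul_left _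
  rw [← hsum.tsum_eq, integral_tsum_of_summable_integral_norm hint]
  · rfl
  · convert hsum.summable using 3 with t
    funext ω
    exact Real.norm_of_nonneg (mul_nonneg (pow_nonneg G.γ_nonneg t) (G.R_mem _ _ _).1)

/-- The term `t = 0` is the reward. One factor `γ` and one application of `stepOp` come out of each
later term, leaving the series of the value at the next state. -/
theorem actionValue_eq (w : Fin S × Fin A × Fin B) :
    actionValue G x y w =
      G.R w.1 w.2.1 w.2.2 + G.γ * ∑ s', G.P w.1 w.2.1 w.2.2 s' * value G x y s' := by
  have h1 : HasSum (fun t : ℕ => G.γ ^ (t + 1) * (stepOp G x y)^[t + 1] (reward G) w)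
      (G.γ * ∑ s', G.P w.1 w.2.1 w.2.2 s' * value G x y s') := by
    have h2 : HasSum (fun t : ℕ => G.γ * ∑ s', G.P w.1 w.2.1 w.2.2 s' *
        ∑ a, ∑ b, x s' a * (y s' b * (G.γ ^ t * (stepOp G x y)^[t] (reward G) (s', a, b))))
        (G.γ * ∑ s', G.P w.1 w.2.1 w.2.2 s' * value G x y s') := by
      simp only [value_eq_sum_actionValue]
      exact (hasSum_sum fun s' _ => (hasSum_sum fun a _ => hasSum_sum fun b _ =>
        ((hasSum_actionValue G x y (s', a, b)).mul_left _).mul_left _).mul_left _).mul_left _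
    convert h2 using 2 with t
    rw [Function.iterate_succ_apply', stepOp, pow_succ', mul_assoc, Finset.mul_sum]
    congr 1
    refine Finset.sum_congr rfl fun s' _ => ?_
    rw [mul_left_comm, Finset.mul_sum]
    congr 1
    refine Finset.sum_congr rfl fun a _ => ?_
    rw [Finset.mul_sum]
    exact Finset.sum_congr rfl fun b _ => by ring
  have h3 := (hasSum_nat_add_iff' 1).1
    (by simpa using h1 : HasSum (fun t : ℕ => G.γ ^ (t + 1) * (stepOp G x y)^[t + 1] (reward G) w)
      ((reward G w + G.γ * ∑ s', G.P w.1 w.2.1 w.2.2 s' * value G x y s') -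
        ∑ i ∈ Finset.range 1, G.γ ^ i * (stepOp G x y)^[i] (reward G) w))
  exact (hasSum_actionValue G x y w).unique h3

/-- The Bellman equation `V^{x,y}(s) = ⟨x_s, Q_s[V^{x,y}] y_s⟩`. -/
theorem value_eq_dotProduct (s : Fin S) :
    value G x y s = ⇑(x s) ⬝ᵥ (bellman G s (value G x y) *ᵥ ⇑(y s)) := by
  rw [value_eq_sum_actionValue]
  simp only [dotProduct, mulVec, Finset.mul_sum, actionValue_eq, bellman]
  exact Finset.sum_congr rfl fun a _ => Finset.sum_congr rfl fun b _ => by ring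

end Value

/-! ### Bilinear payoffs on simplices -/

section MatrixGame

variable {A B : ℕ} {u : Fin A → ℝ} {w : Fin B → ℝ}

theorem dotProduct_le_of_le {q : Fin A → ℝ} {k : ℝ} (hu : u ∈ stdSimplex ℝ (Fin A))
    (h : ∀ a, q a ≤ k) : u ⬝ᵥ q ≤ k :=
  calc u ⬝ᵥ q ≤ ∑ a, u a * k :=
        Finset.sum_le_sum fun a _ => mul_le_mul_of_nonneg_left (h a) (hu.1 a)
    _ = k := by rw [← Finset.sum_mul, hu.2, one_mul]

theorem le_dotProduct_of_le {q : Fin A → ℝ} {k : ℝ} (hu : u ∈ stdSimplex ℝ (Fin A))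
    (h : ∀ a, k ≤ q a) : k ≤ u ⬝ᵥ q :=
  calc k = ∑ a, u a * k := by rw [← Finset.sum_mul, hu.2, one_mul]
    _ ≤ u ⬝ᵥ q := Finset.sum_le_sum fun a _ => mul_le_mul_of_nonneg_left (h a) (hu.1 a)

theorem mulVec_le_of_le {M : Matrix (Fin A) (Fin B) ℝ} {k : ℝ} (hw : w ∈ stdSimplex ℝ (Fin B))
    (h : ∀ a b, M a b ≤ k) (a : Fin A) : (M *ᵥ w) a ≤ k := by
  rw [mulVec, dotProduct_comm]
  exact dotProduct_le_of_le hw (h a)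

theorem le_mulVec_of_le {M : Matrix (Fin A) (Fin B) ℝ} {k : ℝ} (hw : w ∈ stdSimplex ℝ (Fin B))
    (h : ∀ a b, k ≤ M a b) (a : Fin A) : k ≤ (M *ᵥ w) a := by
  rw [mulVec, dotProduct_comm]
  exact le_dotProduct_of_le hw (h a)

theorem payoff_le_add {M N : Matrix (Fin A) (Fin B) ℝ} {e : ℝ} (hu : u ∈ stdSimplex ℝ (Fin A))
    (hw : w ∈ stdSimplex ℝ (Fin B)) (h : ∀ a b, M a b ≤ N a b + e) :
    u ⬝ᵥ (M *ᵥ w) ≤ u ⬝ᵥ (N *ᵥ w) + e := by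
  rw [← sub_le_iff_le_add', ← dotProduct_sub, ← sub_mulVec]
  exact dotProduct_le_of_le hu (mulVec_le_of_le hw fun a b => by
    rw [Matrix.sub_apply]; linarith [h a b])

/-- Split `M w - N w' = (M - N) w + N (w - w')`: the first part averages the entries of `M - N`, the
second is bounded by the `ℓ¹` distance. -/
theorem abs_mulVec_sub_le {M N : Matrix (Fin A) (Fin B) ℝ} {e c : ℝ} {w' : Fin B → ℝ}
    (hw : w ∈ stdSimplex ℝ (Fin B)) (h : ∀ a b, |M a b - N a b| ≤ e) (hN : ∀ a b, |N a b| ≤ c)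
    (a : Fin A) : |(M *ᵥ w) a - (N *ᵥ w') a| ≤ e + c * ∑ b, |w b - w' b| := by
  have h1 : (M *ᵥ w) a - (N *ᵥ w') a = ((M - N) *ᵥ w) a + (N *ᵥ (w - w')) a := by
    simp [sub_mulVec, mulVec_sub]
  rw [h1]
  refine (abs_add_le _ _).trans (add_le_add (abs_le.2 ⟨?_, ?_⟩) ?_)
  · exact le_mulVec_of_le hw (fun a b => (abs_le.1 (h a b)).1) a
  · exact mulVec_le_of_le hw (fun a b => (abs_le.1 (h a b)).2) a
  · rw [mulVec, dotProduct, Finset.mul_sum]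
    refine (Finset.abs_sum_le_sum_abs _ _).trans (Finset.sum_le_sum fun b _ => ?_)
    rw [abs_mul]
    exact mul_le_mul_of_nonneg_right (hN a b) (abs_nonneg _)

/-- Every matrix game has a saddle point. -/
theorem exists_saddle (hA : 0 < A) (hB : 0 < B) (M : Matrix (Fin A) (Fin B) ℝ) :
    ∃ v : ℝ, ∃ u ∈ stdSimplex ℝ (Fin A), ∃ w ∈ stdSimplex ℝ (Fin B),
      (∀ w' ∈ stdSimplex ℝ (Fin B), u ⬝ᵥ (M *ᵥ w') ≤ v) ∧
      ∀ u' ∈ stdSimplex ℝ (Fin A), v ≤ u' ⬝ᵥ (M *ᵥ w) := by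
  have : Nonempty (Fin A) := ⟨⟨0, hA⟩⟩
  have : Nonempty (Fin B) := ⟨⟨0, hB⟩⟩
  have hnA : (stdSimplex ℝ (Fin A)).Nonempty := Set.nonempty_coe_sort.1 inferInstance
  have hnB : (stdSimplex ℝ (Fin B)).Nonempty := Set.nonempty_coe_sort.1 inferInstance
  obtain ⟨u, hu, w, hw, h⟩ := Sion.exists_isSaddlePointOn (X := stdSimplex ℝ (Fin A))
    (Y := stdSimplex ℝ (Fin B)) (f := fun u w => u ⬝ᵥ (M *ᵥ w))
    hnA (convex_stdSimplex ℝ _) (isCompact_stdSimplex ℝ _)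
    (fun w _ => (Continuous.lowerSemicontinuous (by fun_prop)).lowerSemicontinuousOn _)
    (fun w _ => ConvexOn.quasiconvexOn ⟨convex_stdSimplex ℝ _, fun p _ q _ a b _ _ _ => by
      simp [add_dotProduct, smul_dotProduct]⟩)
    (convex_stdSimplex ℝ _) hnB (isCompact_stdSimplex ℝ _)
    (fun u _ => (Continuous.upperSemicontinuous (by fun_prop)).upperSemicontinuousOn _)
    (fun u _ => ConcaveOn.quasiconcaveOn ⟨convex_stdSimplex ℝ _, fun p _ q _ a b _ _ _ => by
      simp [mulVec_add, mulVec_smul, dotProduct_add, dotProduct_smul]⟩)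
  exact ⟨u ⬝ᵥ (M *ᵥ w), u, hu, w, hw, fun w' hw' => h u hu w' hw', fun u' hu' => h u' hu' w hw⟩

end MatrixGame

/-! ### Comparison with value functions -/

section Comparison

variable {S A B : ℕ} (G : MarkovGame S A B)

theorem sum_P (s : Fin S) (a : Fin A) (b : Fin B) : ∑ s', G.P s a b s' = 1 := (G.P s a b).2.2

theorem bellman_le_add {v v' : Fin S → ℝ} {e : ℝ} (h : ∀ s, v s ≤ v' s + e) (s : Fin S)
    (a : Fin A) (b : Fin B) : bellman G s v a b ≤ bellman G s v' a b + G.γ * e := by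
  have h1 : ∑ s', G.P s a b s' * v s' ≤ ∑ s', G.P s a b s' * v' s' + e := by
    calc ∑ s', G.P s a b s' * v s' ≤ ∑ s', G.P s a b s' * (v' s' + e) :=
          Finset.sum_le_sum fun s' _ => mul_le_mul_of_nonneg_left (h s') ((G.P s a b).2.1 s')
      _ = _ := by simp only [mul_add, Finset.sum_add_distrib, ← Finset.sum_mul, sum_P, one_mul]
  have := mul_le_mul_of_nonneg_left h1 G.γ_nonneg
  unfold bellman
  linarith

theorem abs_bellman_sub_le {v v' : Fin S → ℝ} {e : ℝ} (h : ∀ s, |v s - v' s| ≤ e) (s : Fin S)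
    (a : Fin A) (b : Fin B) : |bellman G s v a b - bellman G s v' a b| ≤ G.γ * e := by
  rw [abs_sub_le_iff]
  constructor
  · linarith [bellman_le_add G (fun s => by linarith [(abs_le.1 (h s)).2] : ∀ s, v s ≤ v' s + e)
      s a b]
  · linarith [bellman_le_add G (fun s => by linarith [(abs_le.1 (h s)).1] : ∀ s, v' s ≤ v s + e)
      s a b]

theorem one_sub_γ_pos : 0 < 1 - G.γ := sub_pos.2 G.γ_lt_one

/-- At the state where the gap `v - V^{x,y}` is largest, the Bellman equation gives gap `≤ γ * gap +
e`. This turns a one-step loss into a loss `e / (1 - γ)` of value. -/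
theorem le_value_add (x : Policy S A) (y : Policy S B) {v : Fin S → ℝ} {e : ℝ}
    (h : ∀ s, v s ≤ ⇑(x s) ⬝ᵥ (bellman G s v *ᵥ ⇑(y s)) + e) (s : Fin S) :
    v s ≤ value G x y s + e / (1 - G.γ) := by
  have : Nonempty (Fin S) := ⟨s⟩
  obtain ⟨s₀, hs₀⟩ := Finite.exists_max fun s => v s - value G x y s
  have h1 := payoff_le_add (u := ⇑(x s₀)) (w := ⇑(y s₀)) (x s₀).2 (y s₀).2
    (bellman_le_add G (v := v) (v' := value G x y)
      (e := v s₀ - value G x y s₀) (fun s => by linarith [hs₀ s]) s₀)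
  have h2 := value_eq_dotProduct G x y s₀
  have h3 : v s₀ - value G x y s₀ ≤ e / (1 - G.γ) := by
    rw [le_div_iff₀ (one_sub_γ_pos G)]
    have := h s₀
    linarith
  linarith [hs₀ s]

theorem value_le_add (x : Policy S A) (y : Policy S B) {v : Fin S → ℝ} {e : ℝ}
    (h : ∀ s, ⇑(x s) ⬝ᵥ (bellman G s v *ᵥ ⇑(y s)) ≤ v s + e) (s : Fin S) :
    value G x y s ≤ v s + e / (1 - G.γ) := by
  have : Nonempty (Fin S) := ⟨s⟩
  obtain ⟨s₀, hs₀⟩ := Finite.exists_max fun s => value G x y s - v s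
  have h1 := payoff_le_add (u := ⇑(x s₀)) (w := ⇑(y s₀)) (x s₀).2 (y s₀).2
    (bellman_le_add G (v' := v) (v := value G x y)
      (e := value G x y s₀ - v s₀) (fun s => by linarith [hs₀ s]) s₀)
  have h2 := value_eq_dotProduct G x y s₀
  have h3 : value G x y s₀ - v s₀ ≤ e / (1 - G.γ) := by
    rw [le_div_iff₀ (one_sub_γ_pos G)]
    have := h s₀
    linarith
  linarith [hs₀ s]

theorem value_nonneg (x : Policy S A) (y : Policy S B) (s : Fin S) : 0 ≤ value G x y s := by
  have := le_value_add G x y (v := fun _ => 0) (e := 0) (fun s => by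
    rw [add_zero]
    exact le_dotProduct_of_le (x s).2 (le_mulVec_of_le (y s).2 fun a b => by
      simpa [bellman] using (G.R_mem s a b).1)) s
  simpa using this

theorem value_le (x : Policy S A) (y : Policy S B) (s : Fin S) :
    value G x y s ≤ 1 / (1 - G.γ) := by
  have hc := one_sub_γ_pos G
  have := value_le_add G x y (v := fun _ => 1 / (1 - G.γ)) (e := 0) (fun s => by
    rw [add_zero]
    refine dotProduct_le_of_le (x s).2 (mulVec_le_of_le (y s).2 fun a b => ?_)
    have h1 := (G.R_mem s a b).2
    have h2 : 1 / (1 - G.γ) = 1 + G.γ * (1 / (1 - G.γ)) := by field_simp; ring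
    rw [bellman, ← Finset.sum_mul, sum_P, one_mul]
    linarith) s
  simpa using this

end Comparison

/-! ### The minimax value of the Markov game -/

section Shapley

variable {S A B : ℕ} (G : MarkovGame S A B)

/-- The fixed point of Shapley's operator, with saddle points of its matrix games. -/
theorem exists_shapley (hA : 0 < A) (hB : 0 < B) :
    ∃ (v : Fin S → ℝ) (x : Policy S A) (y : Policy S B),
      (∀ s, ∀ w ∈ stdSimplex ℝ (Fin B), ⇑(x s) ⬝ᵥ (bellman G s v *ᵥ w) ≤ v s) ∧
      ∀ s, ∀ u ∈ stdSimplex ℝ (Fin A), v s ≤ u ⬝ᵥ (bellman G s v *ᵥ ⇑(y s)) := by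
  choose val u hu w hw hmax hmin using exists_saddle hA hB
  -- Compare both values at the mixed pair: the optimal `u` for `N` against the optimal `w` for `M`.
  have hmono : ∀ (M N : Matrix (Fin A) (Fin B) ℝ) (e : ℝ), (∀ a b, M a b ≤ N a b + e) →
      val M ≤ val N + e := fun M N e h =>
    ((hmin M _ (hu N)).trans (payoff_le_add (hu N) (hw M) h)).trans
      (add_le_add_left (hmax N _ (hw M)) e)
  let T : (Fin S → ℝ) → (Fin S → ℝ) := fun v s => val (bellman G s v)
  have hT : ContractingWith G.γ.toNNReal T := by
    refine ⟨by simpa using G.γ_lt_one, LipschitzWith.of_dist_le_mul fun v v' => ?_⟩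
    rw [Real.coe_toNNReal _ G.γ_nonneg, dist_pi_le_iff (mul_nonneg G.γ_nonneg dist_nonneg)]
    intro s
    have hd : ∀ s, |v s - v' s| ≤ dist v v' := fun s => dist_le_pi_dist v v' s
    rw [Real.dist_eq, abs_sub_le_iff]
    constructor
    · refine sub_le_iff_le_add'.2 (hmono _ _ _ fun a b => ?_)
      exact bellman_le_add G (fun s => by linarith [(abs_le.1 (hd s)).2]) s a b
    · refine sub_le_iff_le_add'.2 (hmono _ _ _ fun a b => ?_)
      exact bellman_le_add G (fun s => by linarith [(abs_le.1 (hd s)).1]) s a b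
  have hfix : T (ContractingWith.fixedPoint T hT) = ContractingWith.fixedPoint T hT :=
    hT.fixedPoint_isFixedPt
  generalize ContractingWith.fixedPoint T hT = v at hfix
  refine ⟨v, fun s => ⟨_, hu (bellman G s v)⟩, fun s => ⟨_, hw (bellman G s v)⟩,
    fun s w' hw' => ?_, fun s u' hu' => ?_⟩
  · exact (hmax _ w' hw').trans_eq (congrFun hfix s)
  · exact (congrFun hfix s).symm.trans_le (hmin _ u' hu')

theorem bddAbove_value (x : Policy S A) (s : Fin S) :
    BddAbove (Set.range fun y : Policy S B => value G x y s) :=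
  ⟨1 / (1 - G.γ), by rintro _ ⟨y, rfl⟩; exact value_le G x y s⟩

theorem bddBelow_value (y : Policy S B) (s : Fin S) :
    BddBelow (Set.range fun x : Policy S A => value G x y s) :=
  ⟨0, by rintro _ ⟨x, rfl⟩; exact value_nonneg G x y s⟩

/-- Shapley's theorem: `v^*(s)` is the value of the matrix game `Q^*_s`. -/
theorem exists_optimal (hA : 0 < A) (hB : 0 < B) :
    ∃ (x : Policy S A) (y : Policy S B),
      (∀ s, ∀ w ∈ stdSimplex ℝ (Fin B), ⇑(x s) ⬝ᵥ (Qstar G s *ᵥ w) ≤ gameValue G s) ∧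
      ∀ s, ∀ u ∈ stdSimplex ℝ (Fin A), gameValue G s ≤ u ⬝ᵥ (Qstar G s *ᵥ ⇑(y s)) := by
  obtain ⟨v, x, y, hx, hy⟩ := exists_shapley G hA hB
  have hv : gameValue G = v := by
    funext s
    have : Nonempty (Policy S A) := ⟨x⟩
    have : Nonempty (Policy S B) := ⟨y⟩
    have hbd : BddBelow (Set.range fun x' : Policy S A => valueMaxResp G x' s) :=
      ⟨0, by rintro _ ⟨x', rfl⟩; exact Real.iSup_nonneg fun y' => value_nonneg G x' y' s⟩
    -- `x` guarantees at most `v` against every `y'`, and `y` guarantees at least `v` against every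
    -- `x'`.
    refine le_antisymm ((ciInf_le hbd x).trans (ciSup_le fun y' => ?_)) (le_ciInf fun x' => ?_)
    · simpa using value_le_add G x y' (v := v) (e := 0)
        (fun s => by rw [add_zero]; exact hx s _ (y' s).2) s
    · have := le_value_add G x' y (v := v) (e := 0)
        (fun s => by rw [add_zero]; exact hy s _ (x' s).2) s
      rw [zero_div, add_zero] at this
      exact this.trans (le_ciSup (bddAbove_value G x' s) y)
  unfold Qstar
  rw [hv]
  exact ⟨x, y, hx, hy⟩

theorem gameValue_mem (hA : 0 < A) (hB : 0 < B) (s : Fin S) :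
    gameValue G s ∈ Set.Icc 0 (1 / (1 - G.γ)) := by
  have : Nonempty (Fin A) := ⟨⟨0, hA⟩⟩
  have : Nonempty (Fin B) := ⟨⟨0, hB⟩⟩
  have h0 : ∀ x : Policy S A, 0 ≤ valueMaxResp G x s :=
    fun x => Real.iSup_nonneg fun y => value_nonneg G x y s
  have x₀ : Policy S A := fun _ => Classical.arbitrary _
  exact ⟨Real.iInf_nonneg h0, (ciInf_le ⟨0, by rintro _ ⟨x, rfl⟩; exact h0 x⟩ x₀).trans
    (ciSup_le fun y => value_le G x₀ y s)⟩

theorem abs_Qstar_le (hA : 0 < A) (hB : 0 < B) (s : Fin S) (a : Fin A) (b : Fin B) :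
    |Qstar G s a b| ≤ 1 / (1 - G.γ) := by
  have hc := one_sub_γ_pos G
  have hP := (G.P s a b).2.1
  have h1 : ∑ s', G.P s a b s' * gameValue G s' ≤ 1 / (1 - G.γ) :=
    calc _ ≤ ∑ s', G.P s a b s' * (1 / (1 - G.γ)) := Finset.sum_le_sum fun s' _ =>
          mul_le_mul_of_nonneg_left (gameValue_mem G hA hB s').2 (hP s')
      _ = _ := by rw [← Finset.sum_mul, sum_P, one_mul]
  have h0 : 0 ≤ ∑ s', G.P s a b s' * gameValue G s' :=
    Finset.sum_nonneg fun s' _ => mul_nonneg (hP s') (gameValue_mem G hA hB s').1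
  have hR := G.R_mem s a b
  have h2 : 1 / (1 - G.γ) = 1 + G.γ * (1 / (1 - G.γ)) := by field_simp; ring
  have h3 := mul_le_mul_of_nonneg_left h1 G.γ_nonneg
  have h4 := mul_nonneg G.γ_nonneg h0
  rw [Qstar, bellman, abs_of_nonneg (by linarith [hR.1])]
  linarith [hR.2]

theorem abs_payoff_le (hA : 0 < A) (hB : 0 < B) (s : Fin S) {u : EuclideanSpace ℝ (Fin A)}
    {w : EuclideanSpace ℝ (Fin B)} (hu : u ∈ simplex A) (hw : w ∈ simplex B) :
    |payoff G s u w| ≤ 1 / (1 - G.γ) :=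
  abs_le.2 ⟨le_dotProduct_of_le hu (le_mulVec_of_le hw fun a b =>
    (abs_le.1 (abs_Qstar_le G hA hB s a b)).1), dotProduct_le_of_le hu (mulVec_le_of_le hw
      fun a b => (abs_le.1 (abs_Qstar_le G hA hB s a b)).2)⟩

/-- A minimizer of the worst-case payoff does no worse than the optimal policy of `exists_optimal`,
which guarantees `v^*(s)`. Boundedness of the payoff keeps the real supremum from taking its default
value. -/
theorem payoff_le_of_mem_XstarAt (hA : 0 < A) (hB : 0 < B) {s : Fin S}
    {u : EuclideanSpace ℝ (Fin A)} (hu : u ∈ XstarAt G s) {w : EuclideanSpace ℝ (Fin B)}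
    (hw : w ∈ simplex B) : payoff G s u w ≤ gameValue G s := by
  obtain ⟨x, -, hx, -⟩ := exists_optimal G hA hB
  have hxm : WithLp.toLp 2 ⇑(x s) ∈ simplex A := (x s).2
  have : Nonempty (simplex B) := ⟨⟨w, hw⟩⟩
  calc payoff G s u w ≤ ⨆ w : simplex B, payoff G s u w :=
        le_ciSup (f := fun w : simplex B => payoff G s u w) ⟨1 / (1 - G.γ), by
          rintro _ ⟨w, rfl⟩
          exact (abs_le.1 (abs_payoff_le G hA hB s hu.1 w.2)).2⟩ ⟨w, hw⟩
    _ ≤ ⨆ w : simplex B, payoff G s (WithLp.toLp 2 ⇑(x s)) w := hu.2 hxm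
    _ ≤ gameValue G s := ciSup_le fun w => hx s _ w.2

theorem le_payoff_of_mem_YstarAt (hA : 0 < A) (hB : 0 < B) {s : Fin S}
    {w : EuclideanSpace ℝ (Fin B)} (hw : w ∈ YstarAt G s) {u : EuclideanSpace ℝ (Fin A)}
    (hu : u ∈ simplex A) : gameValue G s ≤ payoff G s u w := by
  obtain ⟨-, y, -, hy⟩ := exists_optimal G hA hB
  have hym : WithLp.toLp 2 ⇑(y s) ∈ simplex B := (y s).2
  have : Nonempty (simplex A) := ⟨⟨u, hu⟩⟩
  calc gameValue G s ≤ ⨅ u : simplex A, payoff G s u (WithLp.toLp 2 ⇑(y s)) :=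
        le_ciInf fun u => hy s _ u.2
    _ ≤ ⨅ u : simplex A, payoff G s u w := hw.2 hym
    _ ≤ payoff G s u w :=
        ciInf_le (f := fun u : simplex A => payoff G s u w) ⟨-(1 / (1 - G.γ)), by
          rintro _ ⟨u, rfl⟩
          exact (abs_le.1 (abs_payoff_le G hA hB s u.2 hw.1)).1⟩ ⟨u, hu⟩

theorem Zstar_nonempty (hA : 0 < A) (hB : 0 < B) : (Zstar G).Nonempty := by
  obtain ⟨x, y, hx, hy⟩ := exists_optimal G hA hB
  refine ⟨pairVec x.toVec y.toVec, fun s => ⟨⟨(x s).2, fun u hu => ?_⟩,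
    ⟨(y s).2, fun w hw => ?_⟩⟩⟩
  · have : Nonempty (simplex B) := ⟨⟨y.toVec s, (y s).2⟩⟩
    calc ⨆ w : simplex B, payoff G s (x.toVec s) w ≤ gameValue G s :=
          ciSup_le fun w => hx s _ w.2
      _ ≤ payoff G s u (y.toVec s) := hy s _ hu
      _ ≤ ⨆ w : simplex B, payoff G s u w :=
          le_ciSup (f := fun w : simplex B => payoff G s u w) ⟨1 / (1 - G.γ), by
            rintro _ ⟨w, rfl⟩
            exact (abs_le.1 (abs_payoff_le G hA hB s hu w.2)).2⟩ ⟨y.toVec s, (y s).2⟩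
  · have : Nonempty (simplex A) := ⟨⟨x.toVec s, (x s).2⟩⟩
    calc ⨅ u : simplex A, payoff G s u w ≤ payoff G s (x.toVec s) w :=
          ciInf_le (f := fun u : simplex A => payoff G s u w) ⟨-(1 / (1 - G.γ)), by
            rintro _ ⟨u, rfl⟩
            exact (abs_le.1 (abs_payoff_le G hA hB s u.2 hw)).1⟩ ⟨x.toVec s, (x s).2⟩
      _ ≤ gameValue G s := hx s _ hw
      _ ≤ ⨅ u : simplex A, payoff G s u (y.toVec s) := le_ciInf fun u => hy s _ u.2

end Shapley

/-! ### Projections onto closed convex sets -/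

section Projection

/-- A nearest point exists, so the choice in `proj` is not a junk value, and nearest points of
convex sets satisfy the obtuse-angle inequality. -/
theorem proj_spec {n : ℕ} {C : Set (EuclideanSpace ℝ (Fin n))} (hne : C.Nonempty)
    (hcl : IsClosed C) (hcv : Convex ℝ C) (v : EuclideanSpace ℝ (Fin n)) :
    proj C v ∈ C ∧ ∀ w ∈ C, inner ℝ (v - proj C v) (w - proj C v) ≤ 0 := by
  obtain ⟨p, hp, hmin⟩ := exists_norm_eq_iInf_of_complete_convex hne hcl.isComplete hcv v
  have hbd : BddBelow (Set.range fun w : C => ‖v - w‖) :=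
    ⟨0, by rintro _ ⟨w, rfl⟩; exact norm_nonneg _⟩
  have hex : ∃ p, p ∈ C ∧ ∀ q ∈ C, ‖v - p‖ ≤ ‖v - q‖ :=
    ⟨p, hp, fun q hq => hmin.trans_le (ciInf_le hbd ⟨q, hq⟩)⟩
  obtain ⟨hmem, hle⟩ : proj C v ∈ C ∧ ∀ q ∈ C, ‖v - proj C v‖ ≤ ‖v - q‖ :=
    Classical.epsilon_spec hex
  refine ⟨hmem, (norm_eq_iInf_iff_real_inner_le_zero hcv hmem).1 (le_antisymm ?_ ?_)⟩
  · have : Nonempty C := ⟨⟨_, hmem⟩⟩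
    exact le_ciInf fun w => hle w w.2
  · exact ciInf_le hbd ⟨_, hmem⟩

/-- If `p'` solves the variational inequality of `q'` on `C`, then it is a fixed point of the
projected step along `-q'`, and projected steps are nonexpansive. -/
theorem norm_proj_sub_le {n : ℕ} {C : Set (EuclideanSpace ℝ (Fin n))} (hcl : IsClosed C)
    (hcv : Convex ℝ C) {p' q' : EuclideanSpace ℝ (Fin n)} (hp' : p' ∈ C)
    (hq' : ∀ w ∈ C, 0 ≤ inner ℝ q' (w - p')) {η : ℝ} (hη : 0 ≤ η)
    (p q : EuclideanSpace ℝ (Fin n)) :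
    ‖proj C (p - η • q) - p'‖ ≤ ‖(p - p') - η • (q - q')‖ := by
  obtain ⟨hmem, hvi⟩ := proj_spec ⟨p', hp'⟩ hcl hcv (p - η • q)
  set r := proj C (p - η • q)
  have h1 := hvi p' hp'
  have h2 := mul_nonneg hη (hq' r hmem)
  -- The last two terms contribute nonpositively by `h2` and `h1`; Cauchy–Schwarz on the first then
  -- leaves one factor `‖r - p'‖` to cancel.
  have h3 : inner ℝ (r - p') (r - p') = inner ℝ ((p - p') - η • (q - q')) (r - p') -
      η * inner ℝ q' (r - p') + inner ℝ (p - η • q - r) (p' - r) := by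
    rw [← neg_sub r p', inner_neg_right]
    simp only [inner_sub_left, real_inner_smul_left]
    ring
  have h4 := real_inner_le_norm ((p - p') - η • (q - q')) (r - p')
  rw [real_inner_self_eq_norm_sq] at h3
  have h5 : ‖r - p'‖ * ‖r - p'‖ ≤ ‖(p - p') - η • (q - q')‖ * ‖r - p'‖ := by nlinarith
  rcases (norm_nonneg (r - p')).eq_or_lt with h | h
  · rw [← h]; exact norm_nonneg _
  · exact le_of_mul_le_mul_right h5 h

theorem isClosed_simplex (n : ℕ) : IsClosed (simplex n) :=
  (isCompact_stdSimplex ℝ (Fin n)).isClosed.preimage (by fun_prop :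
    Continuous fun v : EuclideanSpace ℝ (Fin n) => (⇑v : Fin n → ℝ))

theorem convex_simplex (n : ℕ) : Convex ℝ (simplex n) := fun _ hv _ hw _ _ ha hb hab =>
  convex_stdSimplex ℝ (Fin n) hv hw ha hb hab

theorem nonempty_simplex {n : ℕ} (hn : 0 < n) : (simplex n).Nonempty := by
  have : Nonempty (Fin n) := ⟨⟨0, hn⟩⟩
  obtain ⟨p⟩ : Nonempty (stdSimplex ℝ (Fin n)) := inferInstance
  exact ⟨WithLp.toLp 2 ⇑p, p.2⟩

theorem proj_simplex_mem {n : ℕ} (hn : 0 < n) (v : EuclideanSpace ℝ (Fin n)) :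
    proj (simplex n) v ∈ simplex n :=
  (proj_spec (nonempty_simplex hn) (isClosed_simplex n) (convex_simplex n) v).1

variable {S n : ℕ}

theorem norm_le_of_forall_norm_le {p q : PolSpace S n} (h : ∀ s, ‖p s‖ ≤ ‖q s‖) : ‖p‖ ≤ ‖q‖ := by
  rw [← sq_le_sq₀ (norm_nonneg _) (norm_nonneg _), PiLp.norm_sq_eq_of_L2, PiLp.norm_sq_eq_of_L2]
  exact Finset.sum_le_sum fun s _ => pow_le_pow_left₀ (norm_nonneg _) (h s) 2

/-- The statewise estimates combine in the `ℓ²` sum over states. The bound on the stepsize serves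
only here, to drop the factor `η` on the `q`-error. -/
theorem norm_projected_step_sub_le {x xt q x' q' : PolSpace S n} {η : ℝ} (hη : 0 ≤ η)
    (hη1 : η ≤ 1) (hx : ∀ s, x s = proj (simplex n) (xt s - η • q s)) (hx' : ∀ s, x' s ∈ simplex n)
    (hq' : ∀ s, ∀ w ∈ simplex n, 0 ≤ inner ℝ (q' s) (w - x' s)) :
    ‖x - x'‖ ≤ ‖xt - x'‖ + ‖q - q'‖ := by
  have h1 : ‖x - x'‖ ≤ ‖(xt - x') - η • (q - q')‖ := norm_le_of_forall_norm_le fun s => by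
    have := norm_proj_sub_le (isClosed_simplex n) (convex_simplex n) (hx' s) (hq' s) hη (xt s) (q s)
    rw [← hx s] at this
    exact this
  refine h1.trans ((norm_sub_le _ _).trans (add_le_add_right ?_ _))
  rw [norm_smul, Real.norm_of_nonneg hη]
  exact mul_le_of_le_one_left (norm_nonneg _) hη1

theorem norm_le_of_forall_abs_le {q : PolSpace S n} {e : ℝ} (he : 0 ≤ e)
    (h : ∀ s a, |q s a| ≤ e) : ‖q‖ ≤ √S * √n * e := by
  rw [← sq_le_sq₀ (norm_nonneg _) (by positivity), PiLp.norm_sq_eq_of_L2, mul_pow, mul_pow,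
    Real.sq_sqrt (Nat.cast_nonneg _), Real.sq_sqrt (Nat.cast_nonneg _)]
  calc ∑ s, ‖q s‖ ^ 2 ≤ ∑ _s : Fin S, n * e ^ 2 := by
        refine Finset.sum_le_sum fun s _ => ?_
        rw [EuclideanSpace.norm_sq_eq]
        calc ∑ a, ‖q s a‖ ^ 2 ≤ ∑ _a : Fin n, e ^ 2 :=
              Finset.sum_le_sum fun a _ => pow_le_pow_left₀ (norm_nonneg _) (h s a) 2
          _ = n * e ^ 2 := by simp
    _ = S * n * e ^ 2 := by simp [mul_assoc]

theorem sum_abs_sub_le (y y' : PolSpace S n) (s : Fin S) :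
    ∑ b, |y s b - y' s b| ≤ √n * ‖y - y'‖ := by
  have h1 : ∑ b, |y s b - y' s b| ≤ √n * ‖(y - y') s‖ := by
    rw [← sq_le_sq₀ (Finset.sum_nonneg fun b _ => abs_nonneg _) (by positivity), mul_pow,
      Real.sq_sqrt (Nat.cast_nonneg _), EuclideanSpace.norm_sq_eq]
    simpa using sq_sum_le_card_mul_sum_sq (s := Finset.univ) (f := fun b => |y s b - y' s b|)
  exact h1.trans (mul_le_mul_of_nonneg_left (PiLp.norm_apply_le _ _) (Real.sqrt_nonneg _))

end Projection

/-! ### Averaging weights -/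

section Weights

variable {γ : ℝ}

theorem stepα_one (h0 : 0 ≤ γ) (h1 : γ < 1) : stepα γ 1 = 1 := by
  have : 0 ≤ (1 + γ) / (1 - γ) := div_nonneg (by linarith) (by linarith)
  rw [stepα, Nat.cast_one]
  exact div_self (by linarith)

theorem stepα_mem (h0 : 0 ≤ γ) (h1 : γ < 1) {t : ℕ} (ht : 1 ≤ t) :
    stepα γ t ∈ Set.Icc (0 : ℝ) 1 := by
  have : 0 ≤ (1 + γ) / (1 - γ) := div_nonneg (by linarith) (by linarith)
  have ht' : (1 : ℝ) ≤ t := by exact_mod_cast ht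
  exact ⟨div_nonneg (by linarith) (by linarith), (div_le_one (by linarith)).2 (by linarith)⟩

theorem avgα_nonneg (h0 : 0 ≤ γ) (h1 : γ < 1) (t j : ℕ) : 0 ≤ avgα γ t (j + 1) :=
  mul_nonneg (stepα_mem h0 h1 (by omega)).1 (Finset.prod_nonneg fun k hk => by
    have := (stepα_mem h0 h1 (t := k) (by have := (Finset.mem_Icc.1 hk).1; omega)).2
    linarith)

/-- Passing to the next index scales the old weights by `1 - α` and adds a weight `α`, so the total
stays one; it starts at one because `α_1 = 1`. -/
theorem sum_avgα (h0 : 0 ≤ γ) (h1 : γ < 1) (k : ℕ) :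
    ∑ j ∈ Finset.range (k + 1), avgα γ (k + 1) (j + 1) = 1 := by
  induction k with
  | zero => simp [avgα, stepα_one h0 h1]
  | succ k ih =>
    rw [Finset.sum_range_succ]
    have h : ∀ j ∈ Finset.range (k + 1), avgα γ (k + 1 + 1) (j + 1) =
        avgα γ (k + 1) (j + 1) * (1 - stepα γ (k + 1 + 1)) := fun j hj => by
      have := Finset.mem_range.1 hj
      rw [avgα, avgα, Finset.prod_Icc_succ_top (by omega), mul_assoc]
    rw [Finset.sum_congr rfl h, ← Finset.sum_mul, ih, avgα, Finset.Icc_eq_empty (by omega)]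
    simp

end Weights

/-! ### Stability of the `Q`-vectors around an equilibrium -/

section Equilibrium

variable {S A B : ℕ} (G : MarkovGame S A B) {x' : PolSpace S A} {y' : PolSpace S B}

theorem abs_qlo_sub_le (hA : 0 < A) (hB : 0 < B) {V : Fin S → ℝ} {y : PolSpace S B} {e : ℝ}
    (hV : ∀ s, |V s - gameValue G s| ≤ e) (hy : ∀ s, y s ∈ simplex B) (s : Fin S) (a : Fin A) :
    |qlo G V y s a - qlo G (gameValue G) y' s a| ≤
      G.γ * e + 1 / (1 - G.γ) * (√B * ‖y - y'‖) := by
  have hc := one_sub_γ_pos G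
  refine (abs_mulVec_sub_le (hy s) (abs_bellman_sub_le G hV s) (abs_Qstar_le G hA hB s) a).trans ?_
  exact add_le_add_right (mul_le_mul_of_nonneg_left (sum_abs_sub_le y y' s) (by positivity)) _

theorem abs_qhi_sub_le (hA : 0 < A) (hB : 0 < B) {V : Fin S → ℝ} {x : PolSpace S A} {e : ℝ}
    (hV : ∀ s, |V s - gameValue G s| ≤ e) (hx : ∀ s, x s ∈ simplex A) (s : Fin S) (b : Fin B) :
    |qhi G V x s b - qhi G (gameValue G) x' s b| ≤
      G.γ * e + 1 / (1 - G.γ) * (√A * ‖x - x'‖) := by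
  have hc := one_sub_γ_pos G
  refine (abs_mulVec_sub_le (M := (bellman G s V).transpose) (N := (Qstar G s).transpose) (hx s)
    (fun b a => abs_bellman_sub_le G hV s a b) (fun b a => abs_Qstar_le G hA hB s a b) b).trans ?_
  exact add_le_add_right (mul_le_mul_of_nonneg_left (sum_abs_sub_le x x' s) (by positivity)) _

theorem dotProduct_qlo (u : EuclideanSpace ℝ (Fin A)) (s : Fin S) :
    ⇑u ⬝ᵥ ⇑(qlo G (gameValue G) y' s) = payoff G s u (y' s) := rfl

theorem dotProduct_qhi (w : EuclideanSpace ℝ (Fin B)) (s : Fin S) :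
    ⇑w ⬝ᵥ ⇑(qhi G (gameValue G) x' s) = payoff G s (x' s) w := by
  change ⇑w ⬝ᵥ ((Qstar G s).transpose *ᵥ ⇑(x' s)) = ⇑(x' s) ⬝ᵥ (Qstar G s *ᵥ ⇑w)
  rw [mulVec_transpose, dotProduct_comm, dotProduct_mulVec]

theorem payoff_single_left (s : Fin S) (a : Fin A) :
    payoff G s (EuclideanSpace.single a 1) (y' s) = qlo G (gameValue G) y' s a := by
  rw [← dotProduct_qlo]
  simp [dotProduct]

theorem payoff_single_right (s : Fin S) (b : Fin B) :
    payoff G s (x' s) (EuclideanSpace.single b 1) = qhi G (gameValue G) x' s b := by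
  rw [← dotProduct_qhi]
  simp [dotProduct]

theorem single_mem_simplex {n : ℕ} (a : Fin n) : EuclideanSpace.single a (1 : ℝ) ∈ simplex n := by
  simpa [simplex] using single_mem_stdSimplex ℝ a

/-- The least entry of `Q^*_s y'_s` is exactly `v^*(s)`: optimality of `y'` puts every entry above
it, and optimality of `x'` puts an average of the entries below it. -/
theorem abs_iInf_sub_gameValue_le (hA : 0 < A) (hB : 0 < B) {s : Fin S} (hx' : x' s ∈ XstarAt G s)
    (hy' : y' s ∈ YstarAt G s) {f : Fin A → ℝ} {e : ℝ}
    (hf : ∀ a, |f a - qlo G (gameValue G) y' s a| ≤ e) : |(⨅ a, f a) - gameValue G s| ≤ e := by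
  have : Nonempty (Fin A) := ⟨⟨0, hA⟩⟩
  obtain ⟨a, ha⟩ : ∃ a, qlo G (gameValue G) y' s a ≤ gameValue G s := by
    by_contra! h
    obtain ⟨a₀, ha₀⟩ := Finite.exists_min fun a => qlo G (gameValue G) y' s a
    have h1 : qlo G (gameValue G) y' s a₀ ≤ payoff G s (x' s) (y' s) :=
      le_dotProduct_of_le hx'.1 ha₀
    linarith [h a₀, payoff_le_of_mem_XstarAt G hA hB hx' hy'.1]
  have hlow : ∀ a, gameValue G s ≤ qlo G (gameValue G) y' s a := fun a => by
    rw [← payoff_single_left]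
    exact le_payoff_of_mem_YstarAt G hA hB hy' (single_mem_simplex a)
  rw [abs_sub_le_iff]
  constructor
  · have := ciInf_le (Set.finite_range f).bddBelow a
    linarith [(abs_le.1 (hf a)).2]
  · have : gameValue G s - e ≤ ⨅ a, f a :=
      le_ciInf fun a => by linarith [hlow a, (abs_le.1 (hf a)).1]
    linarith

theorem abs_iSup_sub_gameValue_le (hA : 0 < A) (hB : 0 < B) {s : Fin S} (hx' : x' s ∈ XstarAt G s)
    (hy' : y' s ∈ YstarAt G s) {f : Fin B → ℝ} {e : ℝ}
    (hf : ∀ b, |f b - qhi G (gameValue G) x' s b| ≤ e) : |(⨆ b, f b) - gameValue G s| ≤ e := by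
  have : Nonempty (Fin B) := ⟨⟨0, hB⟩⟩
  obtain ⟨b, hb⟩ : ∃ b, gameValue G s ≤ qhi G (gameValue G) x' s b := by
    by_contra! h
    obtain ⟨b₀, hb₀⟩ := Finite.exists_max fun b => qhi G (gameValue G) x' s b
    have h1 : payoff G s (x' s) (y' s) ≤ qhi G (gameValue G) x' s b₀ := by
      rw [← dotProduct_qhi]
      exact dotProduct_le_of_le hy'.1 hb₀
    linarith [h b₀, le_payoff_of_mem_YstarAt G hA hB hy' hx'.1]
  have hup : ∀ b, qhi G (gameValue G) x' s b ≤ gameValue G s := fun b => by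
    rw [← payoff_single_right]
    exact payoff_le_of_mem_XstarAt G hA hB hx' (single_mem_simplex b)
  rw [abs_sub_le_iff]
  constructor
  · have : ⨆ b, f b ≤ gameValue G s + e :=
      ciSup_le fun b => by linarith [hup b, (abs_le.1 (hf b)).2]
    linarith
  · have := le_ciSup (Set.finite_range f).bddAbove b
    linarith [(abs_le.1 (hf b)).1]

/-- The payoff against `y'` is at most `v^*(s)` at `x'` and at least `v^*(s)` at any `w`; this
variational inequality makes `x'` stationary. -/
theorem inner_qlo_nonneg (hA : 0 < A) (hB : 0 < B) {s : Fin S} (hx' : x' s ∈ XstarAt G s)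
    (hy' : y' s ∈ YstarAt G s) {w : EuclideanSpace ℝ (Fin A)} (hw : w ∈ simplex A) :
    0 ≤ inner ℝ (qlo G (gameValue G) y' s) (w - x' s) := by
  have h1 := payoff_le_of_mem_XstarAt G hA hB hx' hy'.1
  have h2 := le_payoff_of_mem_YstarAt G hA hB hy' hw
  rw [← dotProduct_qlo] at h1 h2
  have h3 : inner ℝ (qlo G (gameValue G) y' s) (w - x' s) =
      ⇑w ⬝ᵥ ⇑(qlo G (gameValue G) y' s) - ⇑(x' s) ⬝ᵥ ⇑(qlo G (gameValue G) y' s) := by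
    rw [EuclideanSpace.inner_eq_star_dotProduct, star_trivial, ← sub_dotProduct]
    rfl
  linarith

theorem inner_neg_qhi_nonneg (hA : 0 < A) (hB : 0 < B) {s : Fin S} (hx' : x' s ∈ XstarAt G s)
    (hy' : y' s ∈ YstarAt G s) {w : EuclideanSpace ℝ (Fin B)} (hw : w ∈ simplex B) :
    0 ≤ inner ℝ (-qhi G (gameValue G) x' s) (w - y' s) := by
  have h1 := payoff_le_of_mem_XstarAt G hA hB hx' hw
  have h2 := le_payoff_of_mem_YstarAt G hA hB hy' hx'.1
  rw [← dotProduct_qhi] at h1 h2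
  have h3 : inner ℝ (qhi G (gameValue G) x' s) (w - y' s) =
      ⇑w ⬝ᵥ ⇑(qhi G (gameValue G) x' s) - ⇑(y' s) ⬝ᵥ ⇑(qhi G (gameValue G) x' s) := by
    rw [EuclideanSpace.inner_eq_star_dotProduct, star_trivial, ← sub_dotProduct]
    rfl
  rw [inner_neg_left]
  linarith

/-- The policy whose vector is `x'`. -/
def ofVec {n : ℕ} (x' : PolSpace S n) (h : ∀ s, x' s ∈ simplex n) : Policy S n :=
  fun s => ⟨⇑(x' s), h s⟩

/-- Above, the reply `x'` already holds `y` to `v^*`. Below, `y` loses at most `e` in each matrix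
game `Q^*_s`, and `le_value_add` costs one more factor `1 / (1 - γ)`. -/
theorem abs_valueMinResp_sub_le (hA : 0 < A) (hB : 0 < B) (hx' : ∀ s, x' s ∈ XstarAt G s)
    (hy' : ∀ s, y' s ∈ YstarAt G s) (y : Policy S B) (s : Fin S) :
    |valueMinResp G y s - gameValue G s| ≤
      1 / (1 - G.γ) * (√B * ‖y.toVec - y'‖) / (1 - G.γ) := by
  have hc := one_sub_γ_pos G
  set e := 1 / (1 - G.γ) * (√B * ‖y.toVec - y'‖) with he
  have he0 : 0 ≤ e / (1 - G.γ) := by positivity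
  have : Nonempty (Policy S A) := ⟨ofVec x' fun s => (hx' s).1⟩
  have hup : valueMinResp G y s ≤ gameValue G s := by
    refine (ciInf_le (bddBelow_value G y s) (ofVec x' fun s => (hx' s).1)).trans ?_
    have := value_le_add G (ofVec x' fun s => (hx' s).1) y (v := gameValue G) (e := 0)
      (fun s => by
        rw [add_zero]
        exact payoff_le_of_mem_XstarAt G hA hB (hx' s)
          (w := WithLp.toLp 2 ⇑(y s)) (y s).2) s
    simpa using this
  have hlow : gameValue G s - e / (1 - G.γ) ≤ valueMinResp G y s := by
    refine le_ciInf fun x => ?_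
    have := le_value_add G x y (v := gameValue G) (e := e) (fun s => by
      have h1 := le_payoff_of_mem_YstarAt G hA hB (hy' s) (u := WithLp.toLp 2 ⇑(x s)) (x s).2
      have h2 : ∀ a, |qlo G (gameValue G) y.toVec s a - qlo G (gameValue G) y' s a| ≤ e :=
        fun a => by
          simpa [he] using abs_qlo_sub_le G hA hB (V := gameValue G) (y := y.toVec) (y' := y')
            (e := 0) (by simp) (fun s => (y s).2) s a
      have h3 := dotProduct_le_of_le (u := ⇑(x s))
        (q := ⇑(qlo G (gameValue G) y' s) - ⇑(qlo G (gameValue G) y.toVec s)) (k := e) (x s).2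
        (fun a => by
          have := (abs_le.1 (h2 a)).1
          simp only [Pi.sub_apply]
          linarith)
      rw [dotProduct_sub] at h3
      change ⇑(x s) ⬝ᵥ (Qstar G s *ᵥ ⇑(y' s)) - ⇑(x s) ⬝ᵥ (Qstar G s *ᵥ ⇑(y s)) ≤ e at h3
      change gameValue G s ≤ ⇑(x s) ⬝ᵥ (Qstar G s *ᵥ ⇑(y' s)) at h1
      change gameValue G s ≤ ⇑(x s) ⬝ᵥ (Qstar G s *ᵥ ⇑(y s)) + e
      linarith) s
    linarith
  rw [abs_sub_le_iff]
  constructor <;> linarith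

theorem abs_valueMaxResp_sub_le (hA : 0 < A) (hB : 0 < B) (hx' : ∀ s, x' s ∈ XstarAt G s)
    (hy' : ∀ s, y' s ∈ YstarAt G s) (x : Policy S A) (s : Fin S) :
    |valueMaxResp G x s - gameValue G s| ≤
      1 / (1 - G.γ) * (√A * ‖x.toVec - x'‖) / (1 - G.γ) := by
  have hc := one_sub_γ_pos G
  set e := 1 / (1 - G.γ) * (√A * ‖x.toVec - x'‖) with he
  have he0 : 0 ≤ e / (1 - G.γ) := by positivity
  have : Nonempty (Policy S B) := ⟨ofVec y' fun s => (hy' s).1⟩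
  have hlow : gameValue G s ≤ valueMaxResp G x s := by
    refine le_trans ?_ (le_ciSup (bddAbove_value G x s) (ofVec y' fun s => (hy' s).1))
    have := le_value_add G x (ofVec y' fun s => (hy' s).1) (v := gameValue G) (e := 0)
      (fun s => by
        rw [add_zero]
        exact le_payoff_of_mem_YstarAt G hA hB (hy' s)
          (u := WithLp.toLp 2 ⇑(x s)) (x s).2) s
    simpa using this
  have hup : valueMaxResp G x s ≤ gameValue G s + e / (1 - G.γ) := by
    refine ciSup_le fun y => ?_
    refine value_le_add G x y (v := gameValue G) (e := e) (fun s => ?_) s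
    have h1 := payoff_le_of_mem_XstarAt G hA hB (hx' s) (w := WithLp.toLp 2 ⇑(y s)) (y s).2
    have h2 : ∀ b, |qhi G (gameValue G) x.toVec s b - qhi G (gameValue G) x' s b| ≤ e :=
      fun b => by
        simpa [he] using abs_qhi_sub_le G hA hB (V := gameValue G) (x := x.toVec) (x' := x')
          (e := 0) (by simp) (fun s => (x s).2) s b
    have h3 := dotProduct_le_of_le (u := ⇑(y s))
      (q := ⇑(qhi G (gameValue G) x.toVec s) - ⇑(qhi G (gameValue G) x' s)) (k := e) (y s).2
      (fun b => (abs_le.1 (h2 b)).2)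
    rw [dotProduct_sub] at h3
    have h4 := dotProduct_qhi G (x' := x.toVec) (WithLp.toLp 2 ⇑(y s)) s
    have h5 := dotProduct_qhi G (x' := x') (WithLp.toLp 2 ⇑(y s)) s
    change ⇑(y s) ⬝ᵥ ⇑(qhi G (gameValue G) x.toVec s) = ⇑(x s) ⬝ᵥ (Qstar G s *ᵥ ⇑(y s)) at h4
    change ⇑(y s) ⬝ᵥ ⇑(qhi G (gameValue G) x' s) = _ at h5
    change ⇑(x s) ⬝ᵥ (Qstar G s *ᵥ ⇑(y s)) ≤ gameValue G s + e
    linarith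
  rw [abs_sub_le_iff]
  constructor <;> linarith

end Equilibrium

/-! ### The iterates of Averaging OGDA -/

section Iteration

variable {S A B : ℕ} (G : MarkovGame S A B) (η : ℝ) (x₀ : Policy S A) (y₀ : Policy S B)

/-- The vector of all `q̲_s` at an iterate. -/
def Iterate.qloVec (z : Iterate S A B) : PolSpace S A := WithLp.toLp 2 (qlo G z.Vlo z.y)

/-- The vector of all `q̅_s` at an iterate. -/
def Iterate.qhiVec (z : Iterate S A B) : PolSpace S B := WithLp.toLp 2 (qhi G z.Vhi z.x)

theorem aogdaAfter_zero : aogdaAfter G η x₀ y₀ 0 =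
    { x := x₀.toVec, xt := x₀.toVec, y := y₀.toVec, yt := y₀.toVec
      Vlo := valueMinResp G y₀, Vhi := valueMaxResp G x₀ } := by
  rw [aogdaAfter]

theorem aogdaAfter_succ_x (k : ℕ) (s : Fin S) : (aogdaAfter G η x₀ y₀ (k + 1)).x s =
    proj (simplex A) ((aogdaAfter G η x₀ y₀ k).xt s -
      η • (aogdaAfter G η x₀ y₀ k).qloVec G s) := by
  rw [aogdaAfter]; rfl

theorem aogdaAfter_succ_y (k : ℕ) (s : Fin S) : (aogdaAfter G η x₀ y₀ (k + 1)).y s =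
    proj (simplex B) ((aogdaAfter G η x₀ y₀ k).yt s +
      η • (aogdaAfter G η x₀ y₀ k).qhiVec G s) := by
  rw [aogdaAfter]; rfl

theorem aogdaAfter_succ_xt (k : ℕ) (s : Fin S) : (aogdaAfter G η x₀ y₀ (k + 1)).xt s =
    proj (simplex A) ((aogdaAfter G η x₀ y₀ k).xt s -
      η • (aogdaAfter G η x₀ y₀ (k + 1)).qloVec G s) := by
  rw [aogdaAfter]; rfl

theorem aogdaAfter_succ_yt (k : ℕ) (s : Fin S) : (aogdaAfter G η x₀ y₀ (k + 1)).yt s =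
    proj (simplex B) ((aogdaAfter G η x₀ y₀ k).yt s +
      η • (aogdaAfter G η x₀ y₀ (k + 1)).qhiVec G s) := by
  rw [aogdaAfter]; rfl

theorem aogdaAfter_succ_Vlo (k : ℕ) (s : Fin S) : (aogdaAfter G η x₀ y₀ (k + 1)).Vlo s =
    ⨅ a : Fin A, ∑ j ∈ Finset.range (k + 1),
      avgα G.γ (k + 1) (j + 1) * (aogdaAfter G η x₀ y₀ j).qloVec G s a := by
  rw [aogdaAfter]
  simp only [Finset.sum_range]
  rfl

theorem aogdaAfter_succ_Vhi (k : ℕ) (s : Fin S) : (aogdaAfter G η x₀ y₀ (k + 1)).Vhi s =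
    ⨆ b : Fin B, ∑ j ∈ Finset.range (k + 1),
      avgα G.γ (k + 1) (j + 1) * (aogdaAfter G η x₀ y₀ j).qhiVec G s b := by
  rw [aogdaAfter]
  simp only [Finset.sum_range]
  rfl

theorem aogdaAfter_x_mem (hA : 0 < A) (k : ℕ) (s : Fin S) :
    (aogdaAfter G η x₀ y₀ k).x s ∈ simplex A := by
  cases k with
  | zero => rw [aogdaAfter_zero]; exact (x₀ s).2
  | succ k => rw [aogdaAfter_succ_x]; exact proj_simplex_mem hA _

theorem aogdaAfter_y_mem (hB : 0 < B) (k : ℕ) (s : Fin S) :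
    (aogdaAfter G η x₀ y₀ k).y s ∈ simplex B := by
  cases k with
  | zero => rw [aogdaAfter_zero]; exact (y₀ s).2
  | succ k => rw [aogdaAfter_succ_y]; exact proj_simplex_mem hB _

theorem abs_sum_avgα_sub_le (k : ℕ) {f : ℕ → ℝ} {c e : ℝ} (h : ∀ j ≤ k, |f j - c| ≤ e) :
    |∑ j ∈ Finset.range (k + 1), avgα G.γ (k + 1) (j + 1) * f j - c| ≤ e := by
  have h1 := sum_avgα G.γ_nonneg G.γ_lt_one k
  have h2 : ∑ j ∈ Finset.range (k + 1), avgα G.γ (k + 1) (j + 1) * f j - c =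
      ∑ j ∈ Finset.range (k + 1), avgα G.γ (k + 1) (j + 1) * (f j - c) := by
    simp only [mul_sub, Finset.sum_sub_distrib, ← Finset.sum_mul, h1, one_mul]
  rw [h2]
  calc _ ≤ ∑ j ∈ Finset.range (k + 1), avgα G.γ (k + 1) (j + 1) * e := by
        refine (Finset.abs_sum_le_sum_abs _ _).trans (Finset.sum_le_sum fun j hj => ?_)
        have hα := avgα_nonneg G.γ_nonneg G.γ_lt_one (k + 1) j
        rw [abs_mul, abs_of_nonneg hα]
        exact mul_le_mul_of_nonneg_left (h j (by have := Finset.mem_range.1 hj; omega)) hα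
    _ = e := by rw [← Finset.sum_mul, h1, one_mul]

/-- The iterate `z` is within `d`, `d'`, `e` of the equilibrium `(x', y')`: its played policies
within `d`, its auxiliary policies within `d'`, its values within `e`. -/
structure Near (x' : PolSpace S A) (y' : PolSpace S B) (z : Iterate S A B) (d d' e : ℝ) :
    Prop where
  x_le : ‖z.x - x'‖ ≤ d
  y_le : ‖z.y - y'‖ ≤ d
  xt_le : ‖z.xt - x'‖ ≤ d'
  yt_le : ‖z.yt - y'‖ ≤ d'
  Vlo_le : ∀ s, |z.Vlo s - gameValue G s| ≤ e
  Vhi_le : ∀ s, |z.Vhi s - gameValue G s| ≤ e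

variable {x' : PolSpace S A} {y' : PolSpace S B}

theorem abs_qloVec_sub_le (hA : 0 < A) (hB : 0 < B) {k : ℕ} {d e : ℝ}
    (hy : ‖(aogdaAfter G η x₀ y₀ k).y - y'‖ ≤ d)
    (hV : ∀ s, |(aogdaAfter G η x₀ y₀ k).Vlo s - gameValue G s| ≤ e) (s : Fin S) (a : Fin A) :
    |(aogdaAfter G η x₀ y₀ k).qloVec G s a - qlo G (gameValue G) y' s a| ≤
      G.γ * e + 1 / (1 - G.γ) * (√(A + B) * d) := by
  have hc := one_sub_γ_pos G
  refine (abs_qlo_sub_le G hA hB hV (aogdaAfter_y_mem G η x₀ y₀ hB k) s a).trans ?_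
  gcongr
  exact le_add_of_nonneg_left (Nat.cast_nonneg A)

theorem abs_qhiVec_sub_le (hA : 0 < A) (hB : 0 < B) {k : ℕ} {d e : ℝ}
    (hx : ‖(aogdaAfter G η x₀ y₀ k).x - x'‖ ≤ d)
    (hV : ∀ s, |(aogdaAfter G η x₀ y₀ k).Vhi s - gameValue G s| ≤ e) (s : Fin S) (b : Fin B) :
    |(aogdaAfter G η x₀ y₀ k).qhiVec G s b - qhi G (gameValue G) x' s b| ≤
      G.γ * e + 1 / (1 - G.γ) * (√(A + B) * d) := by
  have hc := one_sub_γ_pos G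
  refine (abs_qhi_sub_le G hA hB hV (aogdaAfter_x_mem G η x₀ y₀ hA k) s b).trans ?_
  gcongr
  exact le_add_of_nonneg_right (Nat.cast_nonneg B)

/-- Serves both the played and the auxiliary update: they start from the same auxiliary policy and
differ only in `q`. -/
theorem norm_sub_le_of_projected_step_x (hA : 0 < A) (hB : 0 < B) (hη : 0 ≤ η) (hη1 : η ≤ 1)
    (hx' : ∀ s, x' s ∈ XstarAt G s) (hy' : ∀ s, y' s ∈ YstarAt G s)
    {x xt q : PolSpace S A} {r ε : ℝ} (hε : 0 ≤ ε)
    (hx : ∀ s, x s = proj (simplex A) (xt s - η • q s)) (hxt : ‖xt - x'‖ ≤ r)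
    (hq : ∀ s a, |q s a - qlo G (gameValue G) y' s a| ≤ ε) :
    ‖x - x'‖ ≤ r + √S * √(A + B) * ε := by
  refine (norm_projected_step_sub_le (q := q) (q' := WithLp.toLp 2 (qlo G (gameValue G) y'))
    hη hη1 hx (fun s => (hx' s).1)
    (fun s w hw => inner_qlo_nonneg G hA hB (hx' s) (hy' s) hw)).trans (add_le_add hxt ?_)
  refine (norm_le_of_forall_abs_le hε hq).trans ?_
  gcongr
  exact le_add_of_nonneg_right (Nat.cast_nonneg B)

theorem norm_sub_le_of_projected_step_y (hA : 0 < A) (hB : 0 < B) (hη : 0 ≤ η) (hη1 : η ≤ 1)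
    (hx' : ∀ s, x' s ∈ XstarAt G s) (hy' : ∀ s, y' s ∈ YstarAt G s)
    {y yt q : PolSpace S B} {r ε : ℝ} (hε : 0 ≤ ε)
    (hy : ∀ s, y s = proj (simplex B) (yt s + η • q s)) (hyt : ‖yt - y'‖ ≤ r)
    (hq : ∀ s b, |q s b - qhi G (gameValue G) x' s b| ≤ ε) :
    ‖y - y'‖ ≤ r + √S * √(A + B) * ε := by
  refine (norm_projected_step_sub_le (q := -q) (q' := -WithLp.toLp 2 (qhi G (gameValue G) x'))
    hη hη1 (fun s => by rw [hy s, PiLp.neg_apply, smul_neg, sub_neg_eq_add]) (fun s => (hy' s).1)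
    (fun s w hw => inner_neg_qhi_nonneg G hA hB (hx' s) (hy' s) hw)).trans (add_le_add hyt ?_)
  rw [neg_sub_neg, norm_sub_rev]
  refine (norm_le_of_forall_abs_le hε hq).trans ?_
  gcongr
  exact le_add_of_nonneg_left (Nat.cast_nonneg A)

/-- One iteration: `p` bounds the errors of all the past `q`-vectors. -/
theorem Near.succ (hA : 0 < A) (hB : 0 < B) (hη : 0 ≤ η) (hη1 : η ≤ 1)
    (hx' : ∀ s, x' s ∈ XstarAt G s) (hy' : ∀ s, y' s ∈ YstarAt G s) {k : ℕ} {d d' e : ℕ → ℝ}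
    {p p' : ℝ} (hp0 : 0 ≤ p) (h : ∀ j ≤ k, Near G x' y' (aogdaAfter G η x₀ y₀ j) (d j) (d' j) (e j))
    (hp : ∀ j ≤ k, G.γ * e j + 1 / (1 - G.γ) * (√(A + B) * d j) ≤ p)
    (hp' : G.γ * p + 1 / (1 - G.γ) * (√(A + B) * (d' k + √S * √(A + B) * p)) ≤ p') :
    Near G x' y' (aogdaAfter G η x₀ y₀ (k + 1)) (d' k + √S * √(A + B) * p)
      (d' k + √S * √(A + B) * p') p := by
  have hlo : ∀ j ≤ k, ∀ s a,
      |(aogdaAfter G η x₀ y₀ j).qloVec G s a - qlo G (gameValue G) y' s a| ≤ p := fun j hj s a =>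
    (abs_qloVec_sub_le G η x₀ y₀ hA hB (h j hj).y_le (h j hj).Vlo_le s a).trans (hp j hj)
  have hhi : ∀ j ≤ k, ∀ s b,
      |(aogdaAfter G η x₀ y₀ j).qhiVec G s b - qhi G (gameValue G) x' s b| ≤ p := fun j hj s b =>
    (abs_qhiVec_sub_le G η x₀ y₀ hA hB (h j hj).x_le (h j hj).Vhi_le s b).trans (hp j hj)
  have hVlo : ∀ s, |(aogdaAfter G η x₀ y₀ (k + 1)).Vlo s - gameValue G s| ≤ p := fun s => by
    rw [aogdaAfter_succ_Vlo]
    exact abs_iInf_sub_gameValue_le G hA hB (hx' s) (hy' s) fun a =>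
      abs_sum_avgα_sub_le G k fun j hj => hlo j hj s a
  have hVhi : ∀ s, |(aogdaAfter G η x₀ y₀ (k + 1)).Vhi s - gameValue G s| ≤ p := fun s => by
    rw [aogdaAfter_succ_Vhi]
    exact abs_iSup_sub_gameValue_le G hA hB (hx' s) (hy' s) fun b =>
      abs_sum_avgα_sub_le G k fun j hj => hhi j hj s b
  have hc := one_sub_γ_pos G
  have hk := h k le_rfl
  have hd'0 : 0 ≤ d' k := (norm_nonneg _).trans hk.xt_le
  have hp'0 : 0 ≤ p' := by
    refine le_trans ?_ hp'
    have := G.γ_nonneg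
    positivity
  have hx := norm_sub_le_of_projected_step_x G η hA hB hη hη1 hx' hy' hp0
    (aogdaAfter_succ_x G η x₀ y₀ k) hk.xt_le (hlo k le_rfl)
  have hy := norm_sub_le_of_projected_step_y G η hA hB hη hη1 hx' hy' hp0
    (aogdaAfter_succ_y G η x₀ y₀ k) hk.yt_le (hhi k le_rfl)
  exact ⟨hx, hy,
    norm_sub_le_of_projected_step_x G η hA hB hη hη1 hx' hy' hp'0
      (aogdaAfter_succ_xt G η x₀ y₀ k) hk.xt_le fun s a =>
        (abs_qloVec_sub_le G η x₀ y₀ hA hB hy hVlo s a).trans hp',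
    norm_sub_le_of_projected_step_y G η hA hB hη hη1 hx' hy' hp'0
      (aogdaAfter_succ_yt G η x₀ y₀ k) hk.yt_le fun s b =>
        (abs_qhiVec_sub_le G η x₀ y₀ hA hB hx hVhi s b).trans hp', hVlo, hVhi⟩

theorem Near.zero (hA : 0 < A) (hB : 0 < B)
    (hx' : ∀ s, x' s ∈ XstarAt G s) (hy' : ∀ s, y' s ∈ YstarAt G s) {d : ℝ}
    (hx : ‖x₀.toVec - x'‖ ≤ d) (hy : ‖y₀.toVec - y'‖ ≤ d) :
    Near G x' y' (aogdaAfter G η x₀ y₀ 0) d d (1 / (1 - G.γ) * (√(A + B) * d) / (1 - G.γ)) := by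
  have hc := one_sub_γ_pos G
  rw [aogdaAfter_zero]
  refine ⟨hx, hy, hx, hy, fun s => ?_, fun s => ?_⟩
  · refine (abs_valueMinResp_sub_le G hA hB hx' hy' y₀ s).trans ?_
    gcongr
    exact le_add_of_nonneg_left (Nat.cast_nonneg A)
  · refine (abs_valueMaxResp_sub_le G hA hB hx' hy' x₀ s).trans ?_
    gcongr
    exact le_add_of_nonneg_right (Nat.cast_nonneg B)

theorem Near.mono {z : Iterate S A B} {d d' e f f' g : ℝ} (h : Near G x' y' z d d' e)
    (hd : d ≤ f) (hd' : d' ≤ f') (he : e ≤ g) : Near G x' y' z f f' g :=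
  ⟨h.x_le.trans hd, h.y_le.trans hd, h.xt_le.trans hd', h.yt_le.trans hd',
    fun s => (h.Vlo_le s).trans he, fun s => (h.Vhi_le s).trans he⟩

/-- With `c = 1 / (1 - γ)` and `n = A + B`: the growth factor `4 √S n c²` of the iteration. -/
theorem near_aogdaAfter (hS : 0 < S) (hA : 0 < A) (hB : 0 < B) (hη : 0 ≤ η) (hη1 : η ≤ 1)
    (hx' : ∀ s, x' s ∈ XstarAt G s) (hy' : ∀ s, y' s ∈ YstarAt G s) {d : ℝ}
    (hx : ‖x₀.toVec - x'‖ ≤ d) (hy : ‖y₀.toVec - y'‖ ≤ d) (k : ℕ) :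
    Near G x' y' (aogdaAfter G η x₀ y₀ k)
      ((4 * (√S * (A + B) * (1 / (1 - G.γ)) ^ 2)) ^ k * d)
      (2 * (√S * (A + B) * (1 / (1 - G.γ))) *
        ((4 * (√S * (A + B) * (1 / (1 - G.γ)) ^ 2)) ^ k * d))
      ((1 / (1 - G.γ)) ^ 2 * √(A + B) *
        ((4 * (√S * (A + B) * (1 / (1 - G.γ)) ^ 2)) ^ k * d)) := by
  have hd : 0 ≤ d := (norm_nonneg _).trans hx
  have hγ := G.γ_nonneg
  have hc := one_sub_γ_pos G
  set c := 1 / (1 - G.γ) with hcdef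
  have hc1 : 1 ≤ c := by rw [hcdef, le_div_iff₀ hc]; linarith
  have hcγ : G.γ * c = c - 1 := by rw [hcdef]; field_simp; ring
  set m := √((A : ℝ) + B) with hm
  have hmm : m * m = (A : ℝ) + B := Real.mul_self_sqrt (by positivity)
  have hm1 : 1 ≤ (A : ℝ) + B := by
    have : (1 : ℝ) ≤ A := by exact_mod_cast hA
    linarith [(Nat.cast_nonneg B : (0 : ℝ) ≤ B)]
  have hσ1 : 1 ≤ √(S : ℝ) := Real.one_le_sqrt.2 (by exact_mod_cast hS)
  have hm0 : 0 ≤ m := Real.sqrt_nonneg _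
  set σ := √(S : ℝ)
  rw [← hmm] at hm1 ⊢
  set a := σ * (m * m) * c ^ 2 with ha
  set b := σ * (m * m) * c with hb
  have hb1 : 1 ≤ b := one_le_mul_of_one_le_of_one_le (one_le_mul_of_one_le_of_one_le hσ1 hm1) hc1
  have hba : a = b * c := by rw [ha, hb]; ring
  have hab : b ≤ a := by rw [hba]; exact le_mul_of_one_le_right (by linarith) hc1
  have ha1 : 1 ≤ a := hb1.trans hab
  -- Strong induction, because the new values average the `q`-vectors of all past iterates.
  induction k using Nat.strong_induction_on with
  | _ k ih =>
  cases k with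
  | zero =>
    refine (Near.zero G η x₀ y₀ hA hB hx' hy' hx hy).mono G ?_ ?_ ?_
    · simp
    · rw [pow_zero, one_mul]; nlinarith
    · rw [pow_zero, one_mul, ← hcdef, ← hm, div_eq_mul_one_div _ (1 - G.γ), ← hcdef]
      exact le_of_eq (by ring)
  | succ k =>
    set K := 4 * a with hK
    have hK1 : 1 ≤ K := by linarith
    set P := K ^ k * d with hP
    have hP0 : 0 ≤ P := by positivity
    have hPs : K ^ (k + 1) * d = K * P := by rw [hP]; ring
    -- The value radius `c ^ 2 * m * r` is the fixed point of `e ↦ γ * e + c * m * r`, so `q`-errors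
    -- obey the same bound as value errors.
    have hentry : ∀ r : ℝ, G.γ * (c ^ 2 * m * r) + c * (m * r) = c ^ 2 * m * r := fun r => by
      have : G.γ * c ^ 2 = c ^ 2 - c := by rw [pow_two, ← mul_assoc, hcγ]; ring
      linear_combination m * r * this
    -- `p` is the fixed-point bound at radius `P`, which dominates all earlier radii since `K ≥ 1`.
    -- `p'` bounds the `q`-error at the new iterate, with `γ` replaced by `1` in front of `p`.
    have hsucc := Near.succ G η x₀ y₀ hA hB hη hη1 hx' hy' (k := k)
      (p := c ^ 2 * m * P)
      (p' := c ^ 2 * m * P + c * (m * (2 * b * P + σ * m * (c ^ 2 * m * P))))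
      (by positivity) (fun j hj => ih j (by omega)) (fun j hj => by
        rw [← hcdef, ← hm, hentry]
        have : K ^ j * d ≤ P := mul_le_mul_of_nonneg_right (pow_le_pow_right₀ hK1 hj) hd
        gcongr)
      (by
        rw [← hcdef, ← hm]
        exact add_le_add_left (mul_le_of_le_one_left (by positivity) G.γ_lt_one.le) _)
    refine hsucc.mono G ?_ ?_ ?_
    · rw [hPs]
      have : σ * m * (c ^ 2 * m * P) = a * P := by rw [ha]; ring
      rw [← hm, this]
      nlinarith
    · rw [hPs]
      have h1 : 2 * b * P + √S * m * (c ^ 2 * m * P +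
          c * (m * (2 * b * P + σ * m * (c ^ 2 * m * P)))) =
          (2 * b + a + b * (2 * b + a)) * P := by
        rw [ha, hb]; ring
      -- As `1 ≤ b ≤ a`, the left side is at most `6 * a * b`, while the factor `4` in `K` makes `8
      -- * a * b` available.
      have h2 : 2 * b + a + b * (2 * b + a) ≤ 2 * b * K := by
        have h3 : a ≤ a * b := le_mul_of_one_le_right (by linarith) hb1
        have h4 : b * b ≤ a * b := mul_le_mul_of_nonneg_right hab (by linarith)
        have h5 : b ≤ a * b := le_mul_of_one_le_left (by linarith) ha1
        rw [hK]
        linarith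
      calc _ = (2 * b + a + b * (2 * b + a)) * P := h1
        _ ≤ 2 * b * K * P := mul_le_mul_of_nonneg_right h2 hP0
        _ = _ := by ring
    · rw [hPs]
      have : P ≤ K * P := le_mul_of_one_le_left hP0 hK1
      gcongr

end Iteration

/-! ### Geometric boundedness -/

section Main

variable {S A B : ℕ} (G : MarkovGame S A B) (η : ℝ) (x₀ : Policy S A) (y₀ : Policy S B)

/-- Since `r` is the same for all `z`, the infimum passes through the inequality and no nearest
equilibrium has to be chosen. -/
theorem infDist_le_mul_infDist {X : Type*} [PseudoMetricSpace X] {Z : Set X} (hZ : Z.Nonempty)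
    {p q : X} {r : ℝ} (hr : 0 ≤ r) (h : ∀ z ∈ Z, dist p z ≤ r * dist q z) :
    Metric.infDist p Z ≤ r * Metric.infDist q Z := by
  have : Nonempty Z := hZ.to_subtype
  rw [Metric.infDist_eq_iInf, Metric.infDist_eq_iInf, Real.mul_iInf_of_nonneg hr]
  exact ciInf_mono ⟨0, by rintro _ ⟨z, rfl⟩; exact dist_nonneg⟩ fun z => h z z.2

theorem norm_pair_le (z : PairSpace S A B) : ‖z‖ ≤ ‖z.fst‖ + ‖z.snd‖ := by
  rw [← sq_le_sq₀ (norm_nonneg _) (by positivity), WithLp.prod_norm_sq_eq_of_L2]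
  nlinarith [norm_nonneg z.fst, norm_nonneg z.snd]

theorem norm_fst_le (z : PairSpace S A B) : ‖z.fst‖ ≤ ‖z‖ := by
  rw [← sq_le_sq₀ (norm_nonneg _) (norm_nonneg _), WithLp.prod_norm_sq_eq_of_L2]
  nlinarith [norm_nonneg z.snd]

theorem norm_snd_le (z : PairSpace S A B) : ‖z.snd‖ ≤ ‖z‖ := by
  rw [← sq_le_sq₀ (norm_nonneg _) (norm_nonneg _), WithLp.prod_norm_sq_eq_of_L2]
  nlinarith [norm_nonneg z.fst]

/-- The growth factor of the distance to an equilibrium. -/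
def growth : ℝ := 8 * (√S * (A + B) * (1 / (1 - G.γ)) ^ 2)

theorem one_le_growth (hS : 0 < S) (hA : 0 < A) : 1 ≤ growth G := by
  have hc := one_sub_γ_pos G
  have hc1 : 1 ≤ 1 / (1 - G.γ) := by
    rw [le_div_iff₀ hc]; linarith [G.γ_nonneg]
  have hm1 : 1 ≤ (A : ℝ) + B := by
    have : (1 : ℝ) ≤ A := by exact_mod_cast hA
    linarith [(Nat.cast_nonneg B : (0 : ℝ) ≤ B)]
  have hσ1 : 1 ≤ √(S : ℝ) := Real.one_le_sqrt.2 (by exact_mod_cast hS)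
  have := one_le_mul_of_one_le_of_one_le (one_le_mul_of_one_le_of_one_le hσ1 hm1)
    (one_le_pow₀ hc1 : 1 ≤ (1 / (1 - G.γ)) ^ 2)
  rw [growth]
  linarith

theorem growth_sq :
    growth G ^ 2 = 64 * ((S : ℝ) * ((A : ℝ) + (B : ℝ)) ^ 2 / (1 - G.γ) ^ 4) := by
  rw [growth, mul_pow, mul_pow, mul_pow, Real.sq_sqrt (Nat.cast_nonneg S)]
  field_simp
  ring

theorem dist_pairVec_aogdaAfter_le (hS : 0 < S) (hA : 0 < A) (hB : 0 < B) (hη : 0 ≤ η)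
    (hη1 : η ≤ 1) {z : PairSpace S A B} (hz : z ∈ Zstar G) (k : ℕ) :
    dist (pairVec (aogdaAfter G η x₀ y₀ k).x (aogdaAfter G η x₀ y₀ k).y) z ≤
      growth G ^ k * dist (pairVec x₀.toVec y₀.toVec) z := by
  simp only [dist_eq_norm]
  cases k with
  | zero => rw [aogdaAfter_zero, pow_zero, one_mul]
  | succ k =>
    have h := near_aogdaAfter G η x₀ y₀ hS hA hB hη hη1 (x' := z.fst) (y' := z.snd)
      (fun s => (hz s).1) (fun s => (hz s).2)
      (norm_fst_le (pairVec x₀.toVec y₀.toVec - z)) (norm_snd_le (pairVec x₀.toVec y₀.toVec - z))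
      (k + 1)
    refine (norm_pair_le _).trans ((add_le_add h.x_le h.y_le).trans ?_)
    rw [← add_mul]
    refine mul_le_mul_of_nonneg_right ?_ (norm_nonneg _)
    -- Adding the errors of the two players costs one factor `2`, absorbed by `2 ≤ 2 ^ (k + 1)`;
    -- this is why iteration zero is treated apart.
    have hg : growth G = 2 * (4 * (√S * (A + B) * (1 / (1 - G.γ)) ^ 2)) := by
      rw [growth]; ring
    rw [hg, mul_pow (2 : ℝ), ← two_mul]
    exact mul_le_mul_of_nonneg_right (le_self_pow₀ (one_le_two (α := ℝ)) (Nat.succ_ne_zero k))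
      (by positivity)

theorem averagePair_eq {T₁ T₂ : ℕ} (hT : T₁ ≤ T₂) :
    averagePair G η x₀ y₀ T₁ T₂ = ∑ k ∈ Finset.range (T₂ - T₁ + 1),
      avgα G.γ (T₂ - T₁ + 1) (k + 1) •
        pairVec (aogdaAfter G η x₀ y₀ k).x (aogdaAfter G η x₀ y₀ k).y := by
  have hsum : ∀ {E : Type} [AddCommMonoid E] (f : ℕ → E),
      ∑ t ∈ Finset.Icc T₁ T₂, f (t - T₁) = ∑ k ∈ Finset.range (T₂ - T₁ + 1), f k := by
    intro E _ f
    rw [← Finset.Ico_add_one_right_eq_Icc, Finset.sum_Ico_eq_sum_range,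
      show T₂ + 1 - T₁ = T₂ - T₁ + 1 by omega]
    exact Finset.sum_congr rfl fun k _ => by rw [Nat.add_sub_cancel_left]
  have hpair : ∀ (s : Finset ℕ) (c : ℕ → ℝ) (x : ℕ → PolSpace S A) (y : ℕ → PolSpace S B),
      pairVec (∑ k ∈ s, c k • x k) (∑ k ∈ s, c k • y k) = ∑ k ∈ s, c k • pairVec (x k) (y k) := by
    intro s c x y
    induction s using Finset.cons_induction with
    | empty => simp [pairVec]
    | cons k s hk ih => rw [Finset.sum_cons, Finset.sum_cons, Finset.sum_cons, ← ih]; rfl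
  rw [← hpair]
  exact congrArg₂ pairVec
    (hsum fun k => avgα G.γ (T₂ - T₁ + 1) (k + 1) • (aogdaAfter G η x₀ y₀ k).x)
    (hsum fun k => avgα G.γ (T₂ - T₁ + 1) (k + 1) • (aogdaAfter G η x₀ y₀ k).y)

/-- The average is a convex combination of the iterates, and the bound of the last one dominates
since `growth G ≥ 1`. -/
theorem dist_averagePair_le (hS : 0 < S) (hA : 0 < A) (hB : 0 < B) (hη : 0 ≤ η)
    (hη1 : η ≤ 1) {T₁ T₂ : ℕ} (hT : T₁ ≤ T₂) {z : PairSpace S A B} (hz : z ∈ Zstar G) :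
    dist (averagePair G η x₀ y₀ T₁ T₂) z ≤
      growth G ^ (T₂ - T₁) * dist (pairVec x₀.toVec y₀.toVec) z := by
  rw [averagePair_eq G η x₀ y₀ hT, dist_eq_norm]
  set T := T₂ - T₁
  set w := fun k => avgα G.γ (T + 1) (k + 1)
  have hw : ∑ k ∈ Finset.range (T + 1), w k = 1 := sum_avgα G.γ_nonneg G.γ_lt_one T
  have hw0 : ∀ k, 0 ≤ w k := avgα_nonneg G.γ_nonneg G.γ_lt_one (T + 1)
  have h1 : ∑ k ∈ Finset.range (T + 1),
        w k • pairVec (aogdaAfter G η x₀ y₀ k).x (aogdaAfter G η x₀ y₀ k).y - z =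
      ∑ k ∈ Finset.range (T + 1),
        w k • (pairVec (aogdaAfter G η x₀ y₀ k).x (aogdaAfter G η x₀ y₀ k).y - z) := by
    simp only [smul_sub, Finset.sum_sub_distrib, ← Finset.sum_smul, hw, one_smul]
  rw [h1]
  calc _ ≤ ∑ k ∈ Finset.range (T + 1),
        w k * (growth G ^ T * dist (pairVec x₀.toVec y₀.toVec) z) := by
        refine (norm_sum_le _ _).trans (Finset.sum_le_sum fun k hk => ?_)
        rw [norm_smul, Real.norm_of_nonneg (hw0 k), ← dist_eq_norm]
        refine mul_le_mul_of_nonneg_left ?_ (hw0 k)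
        refine (dist_pairVec_aogdaAfter_le G η x₀ y₀ hS hA hB hη hη1 hz k).trans ?_
        refine mul_le_mul_of_nonneg_right (pow_le_pow_right₀ (one_le_growth G hS hA) ?_)
          dist_nonneg
        have := Finset.mem_range.1 hk
        omega
    _ = _ := by rw [← Finset.sum_mul, hw, one_mul]

end Main

end MG

end

theorem theorem4 :
    ∃ C : ℝ, 0 < C ∧
      ∀ (S A B : ℕ), 0 < S → 0 < A → 0 < B → ∀ G : MG.MarkovGame S A B,
        ∃ D : ℝ, 0 < D ∧ D ≤ C * ((S : ℝ) * ((A : ℝ) + (B : ℝ)) ^ 2 / (1 - G.γ) ^ 4) ∧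
          ∀ (η' : ℝ), 0 < η' → η' ≤ 1 →
            ∀ (T₁ T₂ : ℕ), T₁ ≤ T₂ →
              ∀ (x₀ : MG.Policy S A) (y₀ : MG.Policy S B),
                (∀ t : ℕ, T₁ ≤ t → t ≤ T₂ →
                  Metric.infDist (MG.played G η' x₀ y₀ T₁ t) (MG.Zstar G) ^ 2 ≤
                    D ^ (t - T₁) *
                      Metric.infDist (MG.pairVec x₀.toVec y₀.toVec) (MG.Zstar G) ^ 2) ∧
                Metric.infDist (MG.averagePair G η' x₀ y₀ T₁ T₂) (MG.Zstar G) ^ 2 ≤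
                  D ^ (T₂ - T₁) *
                    Metric.infDist (MG.pairVec x₀.toVec y₀.toVec) (MG.Zstar G) ^ 2 := by
  -- Distances grow by `growth G` per iteration, so squared distances by its square; `64 = 8 ^ 2`.
  refine ⟨64, by norm_num, fun S A B hS hA hB G => ⟨MG.growth G ^ 2, ?_, ?_, ?_⟩⟩
  · exact pow_pos (zero_lt_one.trans_le (MG.one_le_growth G hS hA)) 2
  · exact (MG.growth_sq G).le
  intro η' hη hη1 T₁ T₂ hT x₀ y₀
  have hg : ∀ k, 0 ≤ MG.growth G ^ k :=
    fun k => pow_nonneg (zero_le_one.trans (MG.one_le_growth G hS hA)) k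
  have hsq : ∀ (p : MG.PairSpace S A B) (k : ℕ),
      (∀ z ∈ MG.Zstar G, dist p z ≤
        MG.growth G ^ k * dist (MG.pairVec x₀.toVec y₀.toVec) z) →
      Metric.infDist p (MG.Zstar G) ^ 2 ≤ (MG.growth G ^ 2) ^ k *
        Metric.infDist (MG.pairVec x₀.toVec y₀.toVec) (MG.Zstar G) ^ 2 := fun p k h => by
    rw [pow_right_comm, ← mul_pow]
    exact pow_le_pow_left₀ Metric.infDist_nonneg
      (MG.infDist_le_mul_infDist (MG.Zstar_nonempty G hA hB) (hg k) h) 2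
  exact ⟨fun t _ _ => hsq _ _ fun z hz =>
      MG.dist_pairVec_aogdaAfter_le G η' x₀ y₀ hS hA hB hη.le hη1 hz (t - T₁),
    hsq _ _ fun z hz => MG.dist_averagePair_le G η' x₀ y₀ hS hA hB hη.le hη1 hT hz⟩
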